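/- Let $K$ be a non-empty compact metric space and let $V=\{V(x)\}_{x\in K}$ be a non-negative sample-continuous process with $\mathbb E\{V(x)\}=1$ for all $x\in K$. Let $\Gamma_1<\Gamma_2<\dots$ be the arrival times of a unit rate Poisson process on $(0,\infty)$, and let $V_1,V_2,\dots$ be independent sample-continuous processes, independent of $(\Gamma_j)_j$, each with the law of $V$. For $n\in\mathbb N=\{1,2,\dots\}$ and $x\in K$ put $$Z^{(n)}(x)=\max_{1\le j\le n}\Gamma_j^{-1}V_j(x),\qquad Z^{(\infty)}(x)=\sup_{j\ge 1}\Gamma_j^{-1}V_j(x),$$ and let $Z=\{Z(x)\}_{x\in K}$ be a sample-continuous process that is equal in distribution to $Z^{(\infty)}$ (so $Z$ is simple max-stable with spectral process $V$). For a threshold $\tau>0$ let $$T_\tau=\min\Big\{n\in\mathbb N:\ \Gamma_{n+1}^{-1}\tau<\inf_{x\in K}Z^{(n)}(x)\Big\}\qquad(\min\emptyset=\infty)$$ be the stopping time of the threshold stopping algorithm, whose output is $Z^{(T_\tau)}$. Then: (a) $\displaystyle \mathbb E(T_\tau)\ \ge\ \tau\,\mathbb E\Big\{\frac{1}{\inf_{x\in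 K}Z(x)}\Big\}.$ (b) Equality holds in (a) if and only if $\sup_{x\in K}V(x)\le\tau$ almost surely. Moreover, if $\sup_{x\in K}V(x)\le\tau$ almost surely, then threshold stopping is exact: almost surely $Z^{(T_\tau)}(x)=Z^{(\infty)}(x)$ for all $x\in K$, and consequently $Z^{(T_\tau)}$ is equal in distribution to $Z$. -/

import Mathlib

open MeasureTheory ProbabilityTheory
open scoped NNReal ENNReal

noncomputable section

namespace MaxStable

variable {K Ω Ω₀ Ω' : Type*} [MeasurableSpace Ω] [MeasurableSpace Ω₀] [MeasurableSpace Ω']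

/-- A non-negative sample-continuous stochastic process indexed by `K`: every coordinate is a
random variable and every sample path is continuous. -/
structure IsSampleContinuous [TopologicalSpace K] (X : Ω → K → ℝ≥0) : Prop where
  measurable : ∀ x, Measurable fun ω => X ω x
  continuous : ∀ ω, Continuous (X ω)

/-- A spectral process on `K`: non-negative, sample-continuous, and with mean one at each site. -/
structure IsSpectralProcess [TopologicalSpace K] (V : Ω₀ → K → ℝ≥0) (P₀ : Measure Ω₀) :
    Prop where
  sampleContinuous : IsSampleContinuous V
  mean_one : ∀ x, ∫⁻ ω, (V ω x : ℝ≥0∞) ∂P₀ = 1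

/-- The waiting times between consecutive points; the first one is the first point itself. -/
def interarrival (Γ : ℕ → Ω → ℝ) : ℕ → Ω → ℝ
  | 0 => Γ 0
  | j + 1 => fun ω => Γ (j + 1) ω - Γ j ω

/-- `Γ 0, Γ 1, …` are the consecutive arrival times of a unit rate Poisson process on `(0, ∞)`:
the waiting times are independent and standard exponentially distributed. -/
structure IsUnitPoissonArrivals (Γ : ℕ → Ω → ℝ) (P : Measure Ω) : Prop where
  measurable : ∀ j, Measurable (Γ j)
  law : ∀ j, HasLaw (interarrival Γ j) (expMeasure 1) P
  indep : iIndepFun (interarrival Γ) P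

/-- `Γ` is the sequence of arrival times of a unit rate Poisson process, and `W 0, W 1, …` are
sample-continuous independent marks of the arrival times, independent of these times, each of
them distributed as `V`. Laws of processes are laws on the product space `K → ℝ≥0`. -/
structure IsMarkedPoisson [TopologicalSpace K] (Γ : ℕ → Ω → ℝ) (W : ℕ → Ω → K → ℝ≥0)
    (P : Measure Ω) (V : Ω₀ → K → ℝ≥0) (P₀ : Measure Ω₀) : Prop where
  arrivals : IsUnitPoissonArrivals Γ P
  sampleContinuous : ∀ j, IsSampleContinuous (W j)
  identDistrib : ∀ j, IdentDistrib (W j) V P P₀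
  indep_marks : iIndepFun W P
  indep_arrivals_marks : IndepFun (fun ω j => Γ j ω) (fun ω j => W j ω) P

/-- The pointwise maximum of the first `n` functions `(Γ j)⁻¹ * W j`, for `n : ℕ∞`. It is zero
for `n = 0`, and for `n = ⊤` it is the maximum (supremum) of all of these functions. -/
def partialMax (Γ : ℕ → Ω → ℝ) (W : ℕ → Ω → K → ℝ≥0) (n : ℕ∞) (ω : Ω) (x : K) : ℝ≥0∞ :=
  ⨆ (j : ℕ) (_ : (j : ℕ∞) < n), (W j ω x : ℝ≥0∞) / ENNReal.ofReal (Γ j ω)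

/-- The process `Z` is sample-continuous, and it is equal in distribution to the maximum of all the
functions `(Γ j)⁻¹ * W j`. -/
structure HasSpectralRepresentation [TopologicalSpace K] (Z : Ω' → K → ℝ≥0) (P' : Measure Ω')
    (Γ : ℕ → Ω → ℝ) (W : ℕ → Ω → K → ℝ≥0) (P : Measure Ω) : Prop where
  sampleContinuous : IsSampleContinuous Z
  identDistrib : IdentDistrib (fun ω' x => (Z ω' x : ℝ≥0∞)) (partialMax Γ W ⊤) P' P

/-- The stopping time of the threshold stopping algorithm: the least `n ≥ 1` such that `τ` divided
by the arrival time number `n + 1` (this is `Γ n`, as the numbering starts with `Γ 0`) is below the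
infimum over `K` of the maximum of the first `n` functions; it is `⊤` if there is no such `n`. -/
def stoppingTime (Γ : ℕ → Ω → ℝ) (W : ℕ → Ω → K → ℝ≥0) (τ : ℝ≥0) (ω : Ω) : ℕ∞ :=
  ⨅ (n : ℕ) (_ : 1 ≤ n ∧
    (τ : ℝ≥0∞) / ENNReal.ofReal (Γ n ω) < ⨅ x : K, partialMax Γ W n ω x), (n : ℕ∞)

/-- The output of the threshold stopping algorithm. -/
def stoppedMax (Γ : ℕ → Ω → ℝ) (W : ℕ → Ω → K → ℝ≥0) (τ : ℝ≥0) (ω : Ω) (x : K) : ℝ≥0∞ :=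
  partialMax Γ W (stoppingTime Γ W τ ω) ω x

end MaxStable

end

noncomputable section

namespace MaxStable

/-! Write `G_n` for the arrival times (`G_0 = 0`) and `H_n = τ / inf Z^(n)` for the running horizon.
Stopping at `n` means `G_(n+1) > H_n`. As `G` increases and `H` decreases, `T = ∑ n, 1{G_(n+1) ≤
H_n}`.

Given the past, the next waiting time `X` is standard exponential, and `P(X ≤ c) = E min(X, c)`.
Hence `E T = E ∑ n, (min(G_(n+1), H_n) - G_n)⁺` (`lintegral_stoppingTime`), the mean total time
spent below the running horizons. Since `H_n ≥ H_∞` and the intervals `[G_n, G_(n+1))` tile the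
half-line, this sum is at least `H_∞`, whose mean is `τ E(1 / inf Z)`. This proves (a).

If the marks are at most `τ`, those from index `n` on contribute at most `τ / G_(n+1)`, so
`min(G_(n+1), H_n) ≤ H_∞` and the sum equals `H_∞`. Conversely, if `V` exceeds `τ` at a site with
positive probability, mean one and compactness yield finitely many marks and arrival times, of
positive probability, for which the sum is strictly larger (`horizon_top_lt_tsum`). As `E H_∞ < ∞`,
equality of means is then impossible. -/

/-! ### The standard exponential law. -/

instance isProbabilityMeasure_expMeasure_one : IsProbabilityMeasure (expMeasure 1) :=
  isProbabilityMeasure_expMeasure one_pos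

lemma expMeasure_one_Ioi {u : ℝ} (hu : 0 ≤ u) :
    expMeasure 1 (Set.Ioi u) = ENNReal.ofReal (Real.exp (-u)) := by
  have h : expMeasure 1 (Set.Iic u) = ENNReal.ofReal (1 - Real.exp (-u)) := by
    have := lintegral_exponentialPDF_eq_antiDeriv one_pos u
    rw [if_pos hu, one_mul] at this
    rw [← this, expMeasure, gammaMeasure, withDensity_apply _ measurableSet_Iic]
    rfl
  rw [← Set.compl_Iic, prob_compl_eq_one_sub measurableSet_Iic, h, ← ENNReal.ofReal_one,
    ← ENNReal.ofReal_sub _ (by simpa using hu)]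
  simp

lemma expMeasure_one_ae_pos : ∀ᵐ x ∂expMeasure 1, 0 < x := by
  have := expMeasure_one_Ioi le_rfl
  rw [neg_zero, Real.exp_zero, ENNReal.ofReal_one] at this
  exact (mem_ae_iff_prob_eq_one measurableSet_Ioi).2 this

lemma expMeasure_one_Ioo_ne_zero {a b : ℝ} (ha : 0 ≤ a) (hab : a < b) :
    expMeasure 1 (Set.Ioo a b) ≠ 0 := by
  intro h
  obtain ⟨c, hac, hcb⟩ := exists_between hab
  have h1 : expMeasure 1 (Set.Ioi a) ≤ expMeasure 1 (Set.Ioi c) := by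
    calc expMeasure 1 (Set.Ioi a) ≤ expMeasure 1 (Set.Ioo a b ∪ Set.Ioi c) := by
          apply measure_mono
          intro x hx
          by_cases hxb : x < b
          · exact Or.inl ⟨hx, hxb⟩
          · exact Or.inr (hcb.trans_le (not_lt.1 hxb))
      _ ≤ expMeasure 1 (Set.Ioo a b) + expMeasure 1 (Set.Ioi c) := measure_union_le _ _
      _ = _ := by rw [h, zero_add]
  rw [expMeasure_one_Ioi ha, expMeasure_one_Ioi (ha.trans hac.le),
    ENNReal.ofReal_le_ofReal_iff (Real.exp_pos _).le, Real.exp_le_exp] at h1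
  linarith

lemma volume_pos_ofReal_lt (a : ℝ≥0∞) : volume {u : ℝ | 0 < u ∧ ENNReal.ofReal u < a} = a := by
  induction a with
  | top =>
    have : {u : ℝ | 0 < u ∧ ENNReal.ofReal u < ⊤} = Set.Ioi 0 := by ext; simp
    rw [this, Real.volume_Ioi]
  | coe a =>
    have : {u : ℝ | 0 < u ∧ ENNReal.ofReal u < a} = Set.Ioo 0 (a : ℝ) := by
      ext u
      simp only [Set.mem_ofPred_eq, Set.mem_Ioo, and_congr_right_iff]
      intro hu
      rw [← ENNReal.ofReal_coe_nnreal, ENNReal.ofReal_lt_ofReal_iff_of_nonneg hu.le]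
    rw [this, Real.volume_Ioo]
    simp

/-- The truncated mean of a standard exponential variable is its distribution function. -/
lemma lintegral_min_expMeasure_one (c : ℝ≥0∞) :
    ∫⁻ x, min (ENNReal.ofReal x) c ∂expMeasure 1 = expMeasure 1 {x | ENNReal.ofReal x ≤ c} := by
  have hm : MeasurableSet {p : ℝ × ℝ | 0 < p.2 ∧ ENNReal.ofReal p.2 < min (ENNReal.ofReal p.1) c} :=
    (measurableSet_lt measurable_const measurable_snd).inter
      (measurableSet_lt (ENNReal.measurable_ofReal.comp measurable_snd)
        ((ENNReal.measurable_ofReal.comp measurable_fst).min measurable_const))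
  have hc : MeasurableSet {x : ℝ | 0 < x ∧ ENNReal.ofReal x < c} :=
    (measurableSet_lt measurable_const measurable_id).inter
      (measurableSet_lt ENNReal.measurable_ofReal measurable_const)
  -- Layer cake: after Tonelli the inner integral is the tail `exp (-u)` for `0 < u < c`, which is
  -- also the exponential density at `u`.
  have h1 : ∀ x : ℝ, min (ENNReal.ofReal x) c =
      ∫⁻ u, {p : ℝ × ℝ | 0 < p.2 ∧ ENNReal.ofReal p.2 < min (ENNReal.ofReal p.1) c}.indicator 1
        (x, u) := by
    intro x
    conv_lhs => rw [← volume_pos_ofReal_lt (min (ENNReal.ofReal x) c)]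
    rw [← lintegral_indicator_one]
    · rfl
    · exact measurable_prodMk_left hm
  rw [lintegral_congr h1, lintegral_lintegral_swap (f := fun x u => {p : ℝ × ℝ | 0 < p.2 ∧
    ENNReal.ofReal p.2 < min (ENNReal.ofReal p.1) c}.indicator 1 (x, u))
    ((measurable_one.indicator hm).aemeasurable)]
  have h2 : ∀ u : ℝ, ∫⁻ x, {p : ℝ × ℝ | 0 < p.2 ∧
      ENNReal.ofReal p.2 < min (ENNReal.ofReal p.1) c}.indicator 1 (x, u) ∂expMeasure 1 =
      {u : ℝ | 0 < u ∧ ENNReal.ofReal u < c}.indicator (exponentialPDF 1) u := by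
    intro u
    by_cases hu : 0 < u ∧ ENNReal.ofReal u < c
    · rw [Set.indicator_of_mem (by exact hu), exponentialPDF_of_nonneg hu.1.le, one_mul, one_mul,
        ← expMeasure_one_Ioi hu.1.le, ← lintegral_indicator_one measurableSet_Ioi]
      refine lintegral_congr fun x => ?_
      refine Set.indicator_const_eq_indicator_const ?_
      change (0 < u ∧ ENNReal.ofReal u < min (ENNReal.ofReal x) c) ↔ u < x
      rw [lt_min_iff, ENNReal.ofReal_lt_ofReal_iff_of_nonneg hu.1.le]
      tauto
    · rw [Set.indicator_of_notMem (by exact hu)]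
      refine lintegral_eq_zero_of_ae_eq_zero (Filter.Eventually.of_forall fun x => ?_)
      refine Set.indicator_of_notMem ?_ _
      rintro ⟨h, h'⟩
      exact hu ⟨h, h'.trans_le (min_le_right _ _)⟩
  rw [lintegral_congr h2, lintegral_indicator hc]
  have h3 : ∫⁻ u in {u : ℝ | 0 < u ∧ ENNReal.ofReal u < c}, exponentialPDF 1 u =
      expMeasure 1 {u : ℝ | 0 < u ∧ ENNReal.ofReal u < c} := by
    rw [expMeasure, gammaMeasure, withDensity_apply _ hc]
    rfl
  rw [h3]
  -- The events with `< c` and `≤ c` differ, up to null sets, by at most one point.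
  have h4 : expMeasure 1 {c.toReal} = 0 := by
    rw [expMeasure, gammaMeasure]
    exact withDensity_absolutelyContinuous _ _ (measure_singleton _)
  refine measure_congr ?_
  have h5 : ∀ᵐ x ∂expMeasure 1, x ≠ c.toReal := by
    simpa [ae_iff] using h4
  filter_upwards [expMeasure_one_ae_pos, h5] with x hx hx'
  apply propext
  change (0 < x ∧ ENNReal.ofReal x < c) ↔ ENNReal.ofReal x ≤ c
  refine ⟨fun h => h.2.le, fun h => ⟨hx, lt_of_le_of_ne h ?_⟩⟩
  rintro rfl
  exact hx' (ENNReal.toReal_ofReal hx.le).symm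

lemma lintegral_ofReal_expMeasure_one : ∫⁻ x, ENNReal.ofReal x ∂expMeasure 1 = 1 := by
  simpa using lintegral_min_expMeasure_one ⊤

/-- For a standard exponential waiting time `x` after time `a`, the chance that `a + x` comes
before `r` is the mean time spent before `r`. -/
lemma expMeasure_one_add_le {a r : ℝ≥0∞} (ha : a ≠ ∞) :
    expMeasure 1 {x | a + ENNReal.ofReal x ≤ r} =
      ∫⁻ x, (min (a + ENNReal.ofReal x) r - a) ∂expMeasure 1 := by
  rcases le_or_gt a r with h | h
  · have h1 : ∀ x : ℝ, a + ENNReal.ofReal x ≤ r ↔ ENNReal.ofReal x ≤ r - a := fun x => by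
      rw [ENNReal.le_sub_iff_add_le_left ha h]
    have h2 : ∀ y : ℝ≥0∞, min (a + y) r - a = min y (r - a) := fun y => by
      conv_lhs => rw [← add_tsub_cancel_of_le h, min_add_add_left]
      exact ENNReal.add_sub_cancel_left ha
    simp_rw [h1, h2]
    exact (lintegral_min_expMeasure_one _).symm
  · have h1 : ∀ x : ℝ, min (a + ENNReal.ofReal x) r - a = 0 := fun x =>
      tsub_eq_zero_of_le ((min_le_right _ _).trans h.le)
    have h2 : {x : ℝ | a + ENNReal.ofReal x ≤ r} = ∅ := by
      ext x
      simp only [Set.mem_ofPred_eq, Set.mem_empty_iff_false, iff_false, not_le]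
      exact h.trans_le le_self_add
    simp [h1, h2]

/-! ### The stopping index as a count. -/

/-- Since `p` is downward closed, its first failure is the number of indices where it holds. `p 0`
makes the constraint `1 ≤ n` automatic, and both sides are infinite if `p` never fails. -/
lemma coe_iInf_one_le_and_not_eq_tsum (p : ℕ → Prop) (h0 : p 0) (hp : ∀ n, p (n + 1) → p n) :
    ((⨅ (n : ℕ) (_ : 1 ≤ n ∧ ¬ p n), (n : ℕ∞) : ℕ∞) : ℝ≥0∞) =
      ∑' n, {n | p n}.indicator (1 : ℕ → ℝ≥0∞) n := by
  classical
  by_cases hall : ∀ n, p n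
  · have h1 : (⨅ (n : ℕ) (_ : 1 ≤ n ∧ ¬ p n), (n : ℕ∞)) = ⊤ := by
      simp [hall]
    have h2 : {n | p n} = Set.univ := Set.eq_univ_of_forall hall
    rw [h1, h2, Set.indicator_univ]
    simp
  · push Not at hall
    have hanti : ∀ n m, n ≤ m → p m → p n := fun n m hnm => by
      induction hnm with
      | refl => exact id
      | step _ ih => exact fun h => ih (hp _ h)
    have hiff : ∀ n, p n ↔ n < Nat.find hall := fun n => by
      refine ⟨fun h => ?_, fun h => not_not.1 (Nat.find_min hall h)⟩
      by_contra! hle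
      exact Nat.find_spec hall (hanti _ _ hle h)
    have h1 : (⨅ (n : ℕ) (_ : 1 ≤ n ∧ ¬ p n), (n : ℕ∞)) = (Nat.find hall : ℕ) := by
      refine le_antisymm ?_ ?_
      · refine iInf₂_le (Nat.find hall) ⟨?_, Nat.find_spec hall⟩
        exact (hiff 0).1 h0
      · refine le_iInf₂ fun n hn => ?_
        have := (hiff n).not.1 hn.2
        exact_mod_cast not_lt.1 this
    have h2 : {n | p n} = (Finset.range (Nat.find hall) : Set ℕ) := by
      ext n
      rw [Finset.mem_coe, Finset.mem_range, ← hiff n]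
      rfl
    rw [h1, h2, ← tsum_subtype]
    simp

/-- Turns the stopping rule into "the next arrival is beyond the horizon"; `a` may be `0` or `∞`. -/
lemma ENNReal_div_lt_iff_not_le_div {t g a : ℝ≥0∞} (ht : t ≠ 0) (ht' : t ≠ ∞) (hg : g ≠ 0)
    (hg' : g ≠ ∞) : t / g < a ↔ ¬ g ≤ t / a := by
  rw [ENNReal.div_lt_iff (Or.inl hg) (Or.inl hg'),
    ENNReal.le_div_iff_mul_le (Or.inr ht) (Or.inr ht'), not_le, mul_comm]

lemma ENNReal_le_div_div {t g : ℝ≥0∞} (ht : t ≠ 0) (ht' : t ≠ ∞) : g ≤ t / (t / g) := by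
  rw [ENNReal.le_div_iff_mul_le (Or.inr ht) (Or.inr ht')]
  exact ENNReal.mul_div_le

/-! ### Pathwise comparison of arrival times and horizons. -/

/-- The arrival times with waiting times `e`; time number `0` is the origin. -/
def arrivalTime (e : ℕ → ℝ≥0∞) (n : ℕ) : ℝ≥0∞ := ∑ i ∈ Finset.range n, e i

lemma arrivalTime_zero (e : ℕ → ℝ≥0∞) : arrivalTime e 0 = 0 := rfl

lemma arrivalTime_succ (e : ℕ → ℝ≥0∞) (n : ℕ) :
    arrivalTime e (n + 1) = arrivalTime e n + e n := Finset.sum_range_succ _ _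

lemma arrivalTime_mono (e : ℕ → ℝ≥0∞) : Monotone (arrivalTime e) :=
  monotone_nat_of_le_succ fun n => by rw [arrivalTime_succ]; exact le_self_add

lemma arrivalTime_ne_top {e : ℕ → ℝ≥0∞} (he : ∀ i, e i ≠ ∞) (n : ℕ) : arrivalTime e n ≠ ∞ :=
  ENNReal.sum_ne_top.2 fun i _ => he i

lemma arrivalTime_succ_ne_zero {e : ℕ → ℝ≥0∞} (he : ∀ i, e i ≠ 0) (n : ℕ) :
    arrivalTime e (n + 1) ≠ 0 := by
  rw [arrivalTime_succ]
  exact fun h => he n (add_eq_zero.1 h).2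

/-- Each summand is the length of the part of an interarrival interval lying below `r`; truncated
subtraction gives zero once `r` is passed. -/
lemma sum_range_min_arrivalTime (e : ℕ → ℝ≥0∞) (r : ℝ≥0∞) (n : ℕ) :
    ∑ i ∈ Finset.range n, (min (arrivalTime e (i + 1)) r - arrivalTime e i) =
      min (arrivalTime e n) r := by
  induction n with
  | zero => simp [arrivalTime_zero]
  | succ n ih =>
    rw [Finset.sum_range_succ, ih]
    rcases le_total r (arrivalTime e n) with h | h
    · have h' := h.trans (arrivalTime_mono e n.le_succ)
      rw [min_eq_right h, Nat.succ_eq_add_one] at *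
      rw [min_eq_right h', tsub_eq_zero_of_le h, add_zero]
    · rw [min_eq_left h]
      exact add_tsub_cancel_of_le (le_min (arrivalTime_mono e n.le_succ) h)

lemma tsum_min_arrivalTime {e : ℕ → ℝ≥0∞} (he : ∑' i, e i = ∞) (r : ℝ≥0∞) :
    ∑' n, (min (arrivalTime e (n + 1)) r - arrivalTime e n) = r := by
  rw [ENNReal.tsum_eq_iSup_nat]
  simp_rw [sum_range_min_arrivalTime]
  have h : ⨆ n, arrivalTime e n = ∞ := by
    rw [← he, ENNReal.tsum_eq_iSup_nat]
    rfl
  change ⨆ n, arrivalTime e n ⊓ r = r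
  rw [← iSup_inf_eq, h, top_inf_eq]

variable {K : Type*}

/-- The pointwise maximum of the first `n` marks divided by their arrival times. -/
def runningMax (e : ℕ → ℝ≥0∞) (w : ℕ → K → ℝ≥0) (n : ℕ∞) (x : K) : ℝ≥0∞ :=
  ⨆ (j : ℕ) (_ : (j : ℕ∞) < n), (w j x : ℝ≥0∞) / arrivalTime e (j + 1)

/-- The last time at which a mark bounded by `τ` could still exceed the minimum of the running
maximum over the sites `d 0, d 1, …`. -/
def horizon (d : ℕ → K) (τ : ℝ≥0) (e : ℕ → ℝ≥0∞) (w : ℕ → K → ℝ≥0) (n : ℕ∞) : ℝ≥0∞ :=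
  τ / ⨅ k, runningMax e w n (d k)

lemma runningMax_mono (e : ℕ → ℝ≥0∞) (w : ℕ → K → ℝ≥0) (x : K) :
    Monotone fun n => runningMax e w n x := fun _ _ h =>
  iSup_mono fun _ => iSup_mono' fun hj => ⟨hj.trans_le h, le_rfl⟩

lemma le_runningMax_top (e : ℕ → ℝ≥0∞) (w : ℕ → K → ℝ≥0) (j : ℕ) (x : K) :
    (w j x : ℝ≥0∞) / arrivalTime e (j + 1) ≤ runningMax e w ⊤ x :=
  le_iSup₂_of_le j (ENat.natCast_lt_top j) le_rfl

lemma horizon_antitone (d : ℕ → K) (τ : ℝ≥0) (e : ℕ → ℝ≥0∞) (w : ℕ → K → ℝ≥0) :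
    Antitone (horizon d τ e w) := fun _ _ h =>
  ENNReal.div_le_div_left (iInf_mono fun k => runningMax_mono e w (d k) h) _

lemma horizon_zero (d : ℕ → K) {τ : ℝ≥0} (hτ : 0 < τ) (e : ℕ → ℝ≥0∞) (w : ℕ → K → ℝ≥0) :
    horizon d τ e w 0 = ∞ := by
  simp [horizon, runningMax, ENNReal.div_zero, hτ.ne']

/-- With marks bounded by `τ`, no later mark can lower the horizon below the next arrival. -/
lemma min_arrivalTime_horizon_le (d : ℕ → K) {τ : ℝ≥0} (hτ : 0 < τ) (e : ℕ → ℝ≥0∞)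
    {w : ℕ → K → ℝ≥0} (hw : ∀ j k, w j (d k) ≤ τ) (n : ℕ) :
    min (arrivalTime e (n + 1)) (horizon d τ e w n) ≤ horizon d τ e w ⊤ := by
  have hτ0 : (τ : ℝ≥0∞) ≠ 0 := by exact_mod_cast hτ.ne'
  -- Marks with index at least `n` arrive no earlier than `arrivalTime e (n + 1)` and are bounded by
  -- `τ`.
  have h1 : ∀ k, runningMax e w ⊤ (d k) ≤
      runningMax e w n (d k) ⊔ (τ / arrivalTime e (n + 1)) := fun k => by
    refine iSup₂_le fun j _ => ?_
    rcases lt_or_ge j n with h | h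
    · exact le_sup_of_le_left (le_iSup₂_of_le j (by exact_mod_cast h) le_rfl)
    · refine le_sup_of_le_right (ENNReal.div_le_div (by exact_mod_cast hw j k) ?_)
      exact arrivalTime_mono e (Nat.succ_le_succ h)
  have h2 : ⨅ k, runningMax e w ⊤ (d k) ≤
      (⨅ k, runningMax e w n (d k)) ⊔ (τ / arrivalTime e (n + 1)) := by
    rw [iInf_sup_eq]
    exact iInf_mono h1
  refine le_trans ?_ (ENNReal.div_le_div_left h2 _)
  rcases le_total (⨅ k, runningMax e w n (d k)) (τ / arrivalTime e (n + 1)) with h | h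
  · rw [sup_of_le_right h]
    exact (min_le_left _ _).trans (ENNReal_le_div_div hτ0 ENNReal.coe_ne_top)
  · rw [sup_of_le_left h]
    exact min_le_right _ _

/-- The pathwise form of (a): the final horizon is below all running ones, and with it in their
place the sum telescopes to its value. -/
lemma horizon_top_le_tsum (d : ℕ → K) (τ : ℝ≥0) {e : ℕ → ℝ≥0∞} (he : ∑' i, e i = ∞)
    (w : ℕ → K → ℝ≥0) :
    horizon d τ e w ⊤ ≤ ∑' n : ℕ, (min (arrivalTime e (n + 1)) (horizon d τ e w n) -
      arrivalTime e n) := by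
  conv_lhs => rw [← tsum_min_arrivalTime he (horizon d τ e w ⊤)]
  exact ENNReal.tsum_le_tsum fun n =>
    tsub_le_tsub_right (min_le_min_left _ (horizon_antitone d τ e w le_top)) _

lemma tsum_eq_horizon_top (d : ℕ → K) {τ : ℝ≥0} (hτ : 0 < τ) {e : ℕ → ℝ≥0∞}
    (he : ∑' i, e i = ∞) {w : ℕ → K → ℝ≥0} (hw : ∀ j k, w j (d k) ≤ τ) :
    ∑' n : ℕ, (min (arrivalTime e (n + 1)) (horizon d τ e w n) - arrivalTime e n) =
      horizon d τ e w ⊤ := by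
  refine le_antisymm ?_ (horizon_top_le_tsum d τ he w)
  conv_rhs => rw [← tsum_min_arrivalTime he (horizon d τ e w ⊤)]
  exact ENNReal.tsum_le_tsum fun n =>
    tsub_le_tsub_right (le_min (min_le_left _ _) (min_arrivalTime_horizon_le d hτ e hw n)) _

/-- If all marks up to time `τ` are small at one site and the marks of finitely many arrivals
are together large at all sites, then the running horizons exceed the final one. -/
lemma horizon_top_lt_tsum (d : ℕ → K) {τ : ℝ≥0} (hτ : 0 < τ) {e : ℕ → ℝ≥0∞}
    (he : ∑' i, e i = ∞) (he0 : ∀ i, e i ≠ 0) (het : ∀ i, e i ≠ ∞) {w : ℕ → K → ℝ≥0} {m : ℕ}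
    {U : Fin m → Set K} {l r : Fin m → ℝ≥0} (hU : ∀ k, ∃ i, d k ∈ U i) (k₀ : ℕ)
    (hl : ∀ i : Fin m, min (w i (d k₀)) τ ≤ l i)
    (hr : ∀ (i : Fin m) k, d k ∈ U i → r i ≤ w i (d k))
    (hlt : ∀ i : Fin m, (l i : ℝ≥0∞) < arrivalTime e (i + 1))
    (hgt : ∀ i : Fin m, arrivalTime e (i + 1) < r i) :
    horizon d τ e w ⊤ < ∑' n : ℕ, (min (arrivalTime e (n + 1)) (horizon d τ e w n) -
      arrivalTime e n) := by
  classical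
  have hτ0 : (τ : ℝ≥0∞) ≠ 0 := by exact_mod_cast hτ.ne'
  obtain ⟨i₀, hi₀⟩ := hU k₀
  -- At `d k₀` the mark `i₀` exceeds `l i₀`, so the minimum in `hl` must be `τ`. Hence time `τ` is
  -- passed within the first `m` arrivals.
  have hi₀τ : (τ : ℝ≥0∞) < arrivalTime e (i₀ + 1) := by
    refine lt_of_le_of_lt ?_ (hlt i₀)
    have h1 : l i₀ < w i₀ (d k₀) :=
      lt_of_lt_of_le (by exact_mod_cast (hlt i₀).trans (hgt i₀)) (hr i₀ k₀ hi₀)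
    rcases min_le_iff.1 (hl i₀) with h | h
    · exact absurd h1 (not_lt.2 h)
    · exact_mod_cast h
  have hex : ∃ n, (τ : ℝ≥0∞) < arrivalTime e (n + 1) := ⟨i₀, hi₀τ⟩
  have hn0 : Nat.find hex ≤ i₀ := Nat.find_min' hex hi₀τ
  set n := Nat.find hex with hn
  have hnτ : (τ : ℝ≥0∞) < arrivalTime e (n + 1) := Nat.find_spec hex
  have hbefore : ∀ j < n, arrivalTime e (j + 1) ≤ τ := fun j hj => not_lt.1 (Nat.find_min hex hj)
  have hGn : arrivalTime e n ≤ τ := by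
    rcases n with _ | n'
    · simp [arrivalTime_zero]
    · exact hbefore n' n'.lt_succ_self
  -- Every site lies in some `U i`, where the mark `i` exceeds its own arrival time; so the full
  -- maximum is at least one.
  have htop : horizon d τ e w ⊤ ≤ τ := by
    refine ENNReal.div_le_of_le_mul ?_
    refine le_mul_of_one_le_right' (le_iInf fun k => ?_)
    obtain ⟨i, hi⟩ := hU k
    refine le_trans ?_ (le_runningMax_top e w i (d k))
    rw [ENNReal.le_div_iff_mul_le (Or.inl (arrivalTime_succ_ne_zero he0 _))
      (Or.inl (arrivalTime_ne_top het _)), one_mul]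
    exact (hgt i).le.trans (by exact_mod_cast hr i k hi)
  -- Marks arriving by time `τ` are smaller at `d k₀` than their arrival times, so the running
  -- maximum there is below one.
  have hHn : (τ : ℝ≥0∞) < horizon d τ e w n := by
    have hlt1 : ⨅ k, runningMax e w n (d k) < 1 := by
      refine lt_of_le_of_lt (iInf_le _ k₀) ?_
      have heq : runningMax e w n (d k₀) =
          (Finset.range n).sup fun j => (w j (d k₀) : ℝ≥0∞) / arrivalTime e (j + 1) := by
        simp [runningMax, Finset.sup_eq_iSup]
      rw [heq, Finset.sup_lt_iff (by simp)]
      intro j hj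
      have hjn := Finset.mem_range.1 hj
      rw [ENNReal.div_lt_iff (Or.inl (arrivalTime_succ_ne_zero he0 _))
        (Or.inl (arrivalTime_ne_top het _)), one_mul]
      have hjm : j < m := (hjn.trans_le hn0).trans i₀.2
      have h1 := hl ⟨j, hjm⟩
      have h2 := hlt ⟨j, hjm⟩
      rcases min_le_iff.1 h1 with h | h
      · exact lt_of_le_of_lt (by exact_mod_cast h) h2
      · exact absurd (lt_of_le_of_lt (by exact_mod_cast h) h2) (not_lt.2 (hbefore j hjn))
    rw [horizon, ENNReal.lt_div_iff_mul_lt (Or.inr ENNReal.coe_ne_top) (Or.inr hτ0)]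
    conv_rhs => rw [← mul_one (τ : ℝ≥0∞)]
    exact (ENNReal.mul_lt_mul_iff_right hτ0 ENNReal.coe_ne_top).2 hlt1
  conv_lhs => rw [← tsum_min_arrivalTime he (horizon d τ e w ⊤)]
  refine ENNReal.tsum_lt_tsum (i := n) ?_ ?_ ?_
  · rw [tsum_min_arrivalTime he]
    exact (htop.trans_lt ENNReal.coe_lt_top).ne
  · exact fun j => tsub_le_tsub_right
      (min_le_min_left _ (horizon_antitone d τ e w le_top)) _
  -- The term at `n` is strict: arrival `n + 1` and horizon `n` both exceed `τ`, the final horizon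
  -- does not.
  · refine lt_of_le_of_lt (tsub_le_tsub_right ((min_le_right _ _).trans htop) _) ?_
    exact (ENNReal.cancel_of_ne (arrivalTime_ne_top het n)).tsub_lt_tsub_right_of_le hGn
      (lt_min hnτ hHn)

/-- A bound for the horizon by waiting times until finitely many kinds of marks have occurred. -/
lemma horizon_top_le_sum_waiting (d : ℕ → K) (τ : ℝ≥0) {e : ℕ → ℝ≥0∞}
    (he : ∑' i, e i = ∞) (he0 : ∀ i, e i ≠ 0) (het : ∀ i, e i ≠ ∞) (w : ℕ → K → ℝ≥0) {m : ℕ}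
    {U : Fin m → Set K} {r : Fin m → ℝ≥0} (hr0 : ∀ i, 0 < r i) (hU : ∀ k, ∃ i, d k ∈ U i)
    {E : Fin m → Set (K → ℝ≥0)} (hE : ∀ i, ∀ f ∈ E i, ∀ k, d k ∈ U i → r i ≤ f (d k)) :
    horizon d τ e w ⊤ ≤ ∑ i, (τ / r i : ℝ≥0∞) *
      ∑' j : ℕ, e j * {v : ℕ → K → ℝ≥0 | ∀ k < j, v k ∈ (E i)ᶜ}.indicator 1 w := by
  classical
  set B := ∑ i, (τ / r i : ℝ≥0∞) *
      ∑' j : ℕ, e j * {v : ℕ → K → ℝ≥0 | ∀ k < j, v k ∈ (E i)ᶜ}.indicator 1 w with hB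
  rcases eq_or_ne τ 0 with rfl | hτ
  · simp [horizon]
  have hτ0 : (τ : ℝ≥0∞) ≠ 0 := by exact_mod_cast hτ
  rcases eq_or_ne B ∞ with hBt | hBt
  · rw [hBt]
    exact le_top
  have hterm : ∀ i, ∃ N, w N ∈ E i ∧ (τ / r i : ℝ≥0∞) * arrivalTime e (N + 1) ≤ B := fun i => by
    have hle : (τ / r i : ℝ≥0∞) * ∑' j : ℕ, e j *
        {v : ℕ → K → ℝ≥0 | ∀ k < j, v k ∈ (E i)ᶜ}.indicator 1 w ≤ B :=
      Finset.single_le_sum_of_canonicallyOrdered (f := fun i => (τ / r i : ℝ≥0∞) *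
        ∑' j : ℕ, e j * {v : ℕ → K → ℝ≥0 | ∀ k < j, v k ∈ (E i)ᶜ}.indicator 1 w)
        (Finset.mem_univ i)
    -- If no mark fell in `E i`, all indicators would be one and the sum of waiting times would make
    -- `B` infinite.
    have hex : ∃ N, w N ∈ E i := by
      by_contra! hno
      refine hBt (top_le_iff.1 (le_trans (le_of_eq ?_) hle))
      have h1 : ∀ j : ℕ, e j * {v : ℕ → K → ℝ≥0 | ∀ k < j, v k ∈ (E i)ᶜ}.indicator 1 w = e j :=
        fun j => by
          rw [Set.indicator_of_mem (show w ∈ {v : ℕ → K → ℝ≥0 | ∀ k < j, v k ∈ (E i)ᶜ} from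
            fun k _ => hno k), Pi.one_apply, mul_one]
      rw [tsum_congr h1, he, ENNReal.mul_top]
      exact (ENNReal.div_pos hτ0 ENNReal.coe_ne_top).ne'
    -- For the first such `N` the indicators are one for `j ≤ N`, so the series dominates the
    -- arrival time of mark `N`.
    refine ⟨Nat.find hex, Nat.find_spec hex, le_trans (mul_le_mul_right ?_ _) hle⟩
    refine le_trans (le_of_eq (Finset.sum_congr rfl fun j hj => ?_))
      (ENNReal.sum_le_tsum (Finset.range (Nat.find hex + 1)))
    rw [Set.indicator_of_mem, Pi.one_apply, mul_one]
    exact fun k hk => Nat.find_min hex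
      (hk.trans_le (Nat.lt_succ_iff.1 (Finset.mem_range.1 hj)))
  have hB0 : B ≠ 0 := by
    obtain ⟨i, -⟩ := hU 0
    obtain ⟨N, -, hN⟩ := hterm i
    refine (lt_of_lt_of_le ?_ hN).ne'
    exact ENNReal.mul_pos (ENNReal.div_pos hτ0 ENNReal.coe_ne_top).ne'
      (arrivalTime_succ_ne_zero he0 N)
  refine ENNReal.div_le_of_le_mul ?_
  rw [ENNReal.mul_iInf_of_ne hB0 hBt]
  refine le_iInf fun k => ?_
  obtain ⟨i, hi⟩ := hU k
  obtain ⟨N, hNE, hN⟩ := hterm i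
  have hri : (r i : ℝ≥0∞) ≠ 0 := by exact_mod_cast (hr0 i).ne'
  calc (τ : ℝ≥0∞) = (τ / r i : ℝ≥0∞) * arrivalTime e (N + 1) *
        ((r i : ℝ≥0∞) / arrivalTime e (N + 1)) := by
        rw [mul_assoc, ENNReal.mul_div_cancel (arrivalTime_succ_ne_zero he0 N)
          (arrivalTime_ne_top het _), ENNReal.div_mul_cancel hri ENNReal.coe_ne_top]
    _ ≤ B * runningMax e w ⊤ (d k) := by
        refine mul_le_mul' hN (le_trans ?_ (le_runningMax_top e w N (d k)))
        exact ENNReal.div_le_div_right (by exact_mod_cast hE i _ hNE k hi) _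

variable {Ω Ω₀ : Type*} [MeasurableSpace Ω] [MeasurableSpace Ω₀]

/-! ### Measurability of arrival times and horizons. -/

section Measurability

variable {α : Type*} [MeasurableSpace α] {e : α → ℕ → ℝ≥0∞} {w : α → ℕ → K → ℝ≥0}

lemma measurable_arrivalTime (he : Measurable e) (n : ℕ) :
    Measurable fun a => arrivalTime (e a) n := by
  unfold arrivalTime
  fun_prop

lemma measurable_runningMax (he : Measurable e) (hw : Measurable w) (n : ℕ∞) (x : K) :
    Measurable fun a => runningMax (e a) (w a) n x := by
  unfold runningMax
  refine Measurable.iSup fun j => Measurable.iSup fun _ => ?_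
  exact Measurable.div (by fun_prop) (measurable_arrivalTime he _)

lemma measurable_horizon (d : ℕ → K) (τ : ℝ≥0) (he : Measurable e) (hw : Measurable w) (n : ℕ∞) :
    Measurable fun a => horizon d τ (e a) (w a) n :=
  measurable_const.div (Measurable.iInf fun k => measurable_runningMax he hw n (d k))

end Measurability

/-! ### Waiting times of the Poisson process. -/

/-- The waiting times as extended non-negative numbers. -/
def waiting (Γ : ℕ → Ω → ℝ) (ω : Ω) (i : ℕ) : ℝ≥0∞ := ENNReal.ofReal (interarrival Γ i ω)

lemma sum_interarrival {α : Type*} (Γ : ℕ → α → ℝ) (j : ℕ) (ω : α) :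
    ∑ i ∈ Finset.range (j + 1), interarrival Γ i ω = Γ j ω := by
  induction j with
  | zero => simp [interarrival]
  | succ j ih => rw [Finset.sum_range_succ, ih]; simp [interarrival]

namespace IsUnitPoissonArrivals

variable {Γ : ℕ → Ω → ℝ} {P : Measure Ω}

lemma measurable_interarrival (h : IsUnitPoissonArrivals Γ P) (i : ℕ) :
    Measurable (interarrival Γ i) := by
  cases i with
  | zero => exact h.measurable 0
  | succ i => exact (h.measurable (i + 1)).sub (h.measurable i)

lemma measurable_waiting (h : IsUnitPoissonArrivals Γ P) : Measurable (waiting Γ) :=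
  measurable_pi_lambda _ fun i => (h.measurable_interarrival i).ennreal_ofReal

lemma ae_interarrival_pos (h : IsUnitPoissonArrivals Γ P) :
    ∀ᵐ ω ∂P, ∀ i, 0 < interarrival Γ i ω := by
  rw [ae_all_iff]
  intro i
  have := expMeasure_one_ae_pos
  rw [← (h.law i).map_eq] at this
  exact ae_of_ae_map (h.measurable_interarrival i).aemeasurable this

lemma ae_waiting_ne_zero (h : IsUnitPoissonArrivals Γ P) : ∀ᵐ ω ∂P, ∀ i, waiting Γ ω i ≠ 0 := by
  filter_upwards [h.ae_interarrival_pos] with ω hω i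
  exact (ENNReal.ofReal_pos.2 (hω i)).ne'

lemma ae_ofReal_eq_arrivalTime (h : IsUnitPoissonArrivals Γ P) :
    ∀ᵐ ω ∂P, ∀ j, ENNReal.ofReal (Γ j ω) = arrivalTime (waiting Γ ω) (j + 1) := by
  filter_upwards [h.ae_interarrival_pos] with ω hω j
  rw [← sum_interarrival Γ, ENNReal.ofReal_sum_of_nonneg fun i _ => (hω i).le]
  rfl

lemma measure_waiting_mem (h : IsUnitPoissonArrivals Γ P) (i : ℕ) {s : Set ℝ}
    (hs : MeasurableSet s) : P (interarrival Γ i ⁻¹' s) = expMeasure 1 s := by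
  rw [← (h.law i).map_eq, Measure.map_apply (h.measurable_interarrival i) hs]

lemma lintegral_waiting (h : IsUnitPoissonArrivals Γ P) (i : ℕ) :
    ∫⁻ ω, waiting Γ ω i ∂P = 1 := by
  rw [← lintegral_ofReal_expMeasure_one, ← (h.law i).map_eq,
    lintegral_map (by fun_prop) (h.measurable_interarrival i)]
  rfl

/-- By the second Borel–Cantelli lemma, infinitely many waiting times exceed one. -/
lemma ae_tsum_waiting (h : IsUnitPoissonArrivals Γ P) [IsProbabilityMeasure P] :
    ∀ᵐ ω ∂P, ∑' i, waiting Γ ω i = ∞ := by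
  have hmeas : ∀ i, MeasurableSet (interarrival Γ i ⁻¹' Set.Ioi 1) := fun i =>
    h.measurable_interarrival i measurableSet_Ioi
  have hind : iIndepSet (fun i => interarrival Γ i ⁻¹' Set.Ioi 1) P := by
    rw [iIndepSet_iff_meas_biInter hmeas]
    exact fun S => h.indep.measure_inter_preimage_eq_mul S fun i _ => measurableSet_Ioi
  have hsum : ∑' i, P (interarrival Γ i ⁻¹' Set.Ioi 1) = ∞ := by
    simp_rw [h.measure_waiting_mem _ measurableSet_Ioi, expMeasure_one_Ioi zero_le_one]
    refine ENNReal.tsum_const_eq_top_of_ne_zero ?_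
    exact (ENNReal.ofReal_pos.2 (Real.exp_pos _)).ne'
  have := measure_limsup_eq_one hmeas hind hsum
  have hae := (mem_ae_iff_prob_eq_one (MeasurableSet.measurableSet_limsup hmeas)).2 this
  filter_upwards [hae] with ω hω
  by_contra hne
  have hfin := ENNReal.finite_const_le_of_tsum_ne_top hne one_ne_zero
  rw [Filter.mem_limsup_iff_frequently_mem] at hω
  refine (Nat.frequently_atTop_iff_infinite.1 hω) (hfin.subset fun i hi => ?_)
  change 1 ≤ ENNReal.ofReal _
  rw [← ENNReal.ofReal_one]
  exact ENNReal.ofReal_le_ofReal (le_of_lt hi)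

end IsUnitPoissonArrivals

/-! ### Independence from the past and compensation. -/

lemma indepFun_prodMk_right {α β γ : Type*} [MeasurableSpace α] [MeasurableSpace β]
    [MeasurableSpace γ] {P : Measure Ω} [IsProbabilityMeasure P] {X : Ω → α} {Y : Ω → β}
    {W : Ω → γ} (hX : Measurable X) (hY : Measurable Y) (hW : Measurable W)
    (hXY : IndepFun X Y P) (hXYW : IndepFun (fun ω => (X ω, Y ω)) W P) :
    IndepFun X (fun ω => (Y ω, W ω)) P := by
  have hYW : IndepFun Y W P := hXYW.comp measurable_snd measurable_id
  rw [indepFun_iff_map_prod_eq_prod_map_map (by fun_prop) (by fun_prop)] at *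
  have := Measure.isProbabilityMeasure_map (μ := P) hX.aemeasurable
  have := Measure.isProbabilityMeasure_map (μ := P) hY.aemeasurable
  have := Measure.isProbabilityMeasure_map (μ := P) hW.aemeasurable
  rw [hYW, ← Measure.prodAssoc_prod, ← hXY, ← hXYW,
    Measure.map_map MeasurableEquiv.prodAssoc.measurable (by fun_prop)]
  rfl

/-- The sequence which agrees with `e` before `n` and is zero from `n` on. -/
def truncate (n : ℕ) (e : ℕ → ℝ≥0∞) (i : ℕ) : ℝ≥0∞ := if i < n then e i else 0

lemma arrivalTime_truncate {n m : ℕ} (h : m ≤ n) (e : ℕ → ℝ≥0∞) :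
    arrivalTime (truncate n e) m = arrivalTime e m :=
  Finset.sum_congr rfl fun _ hi => if_pos ((Finset.mem_range.1 hi).trans_le h)

/-- The horizon after `n` marks ignores waiting times from index `n` on, so it is independent of the
next one. -/
lemma horizon_truncate (d : ℕ → K) (τ : ℝ≥0) (n : ℕ) (e : ℕ → ℝ≥0∞) (w : ℕ → K → ℝ≥0) :
    horizon d τ (truncate n e) w n = horizon d τ e w n := by
  have : ∀ x, runningMax (truncate n e) w n x = runningMax e w n x := fun x => by
    refine iSup_congr fun j => iSup_congr fun hj => ?_
    rw [arrivalTime_truncate (by exact_mod_cast hj)]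
  simp_rw [horizon, this]

namespace IsMarkedPoisson

variable [TopologicalSpace K] {Γ : ℕ → Ω → ℝ} {W : ℕ → Ω → K → ℝ≥0} {P : Measure Ω}
  {V : Ω₀ → K → ℝ≥0} {P₀ : Measure Ω₀}

lemma measurable_mark (h : IsMarkedPoisson Γ W P V P₀) (j : ℕ) : Measurable (W j) :=
  measurable_pi_lambda _ fun x => (h.sampleContinuous j).measurable x

lemma measurable_marks (h : IsMarkedPoisson Γ W P V P₀) : Measurable fun ω j => W j ω :=
  measurable_pi_lambda _ h.measurable_mark

lemma indepFun_interarrival_marks (h : IsMarkedPoisson Γ W P V P₀) :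
    IndepFun (fun ω i => interarrival Γ i ω) (fun ω j => W j ω) P := by
  let φ : (ℕ → ℝ) → ℕ → ℝ := fun g i => i.casesOn (g 0) fun j => g (j + 1) - g j
  have hφ : Measurable φ := measurable_pi_lambda _ fun i => by
    cases i with
    | zero => exact measurable_pi_apply 0
    | succ j => exact (measurable_pi_apply (j + 1)).sub (measurable_pi_apply j)
  have heq : (fun ω i => interarrival Γ i ω) = φ ∘ fun ω j => Γ j ω := by
    ext ω i
    cases i <;> rfl
  rw [heq]
  exact h.indep_arrivals_marks.comp hφ measurable_id

/-- The past may include all marks, even future ones, because the marks are independent of the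
arrival times. -/
lemma indepFun_waiting_past (h : IsMarkedPoisson Γ W P V P₀) [IsProbabilityMeasure P] (n : ℕ) :
    IndepFun (interarrival Γ n)
      (fun ω => (truncate n (waiting Γ ω), fun j => W j ω)) P := by
  have hmi := h.arrivals.measurable_interarrival
  have htr : Measurable fun ω => truncate n (waiting Γ ω) := by
    refine measurable_pi_lambda _ fun i => ?_
    unfold truncate
    split_ifs
    · exact (hmi i).ennreal_ofReal
    · exact measurable_const
  refine indepFun_prodMk_right (hmi n) htr h.measurable_marks ?_ ?_
  · have hdisj : Disjoint {n} (Finset.range n) := by simp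
    have h1 := h.arrivals.indep.indepFun_finset _ _ hdisj hmi
    let φ : (({n} : Finset ℕ) → ℝ) → ℝ := fun f => f ⟨n, by simp⟩
    let ψ : ((Finset.range n) → ℝ) → ℕ → ℝ≥0∞ := fun f i =>
      if hi : i < n then ENNReal.ofReal (f ⟨i, by simpa using hi⟩) else 0
    have hφ : Measurable φ := measurable_pi_apply _
    have hψ : Measurable ψ := by
      refine measurable_pi_lambda _ fun i => ?_
      by_cases hi : i < n
      · simp only [ψ, hi, dif_pos]
        fun_prop
      · simp only [ψ, hi, dif_neg, not_false_eq_true]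
        exact measurable_const
    have heq : (fun ω => truncate n (waiting Γ ω)) =
        ψ ∘ fun ω (i : Finset.range n) => interarrival Γ i ω := by
      ext ω i
      simp only [truncate, waiting, Function.comp, ψ]
      split_ifs <;> rfl
    rw [heq]
    exact h1.comp hφ hψ
  · let φ : (ℕ → ℝ) → ℝ × (ℕ → ℝ≥0∞) := fun f =>
      (f n, truncate n fun i => ENNReal.ofReal (f i))
    have hφ : Measurable φ := by
      refine (measurable_pi_apply n).prodMk (measurable_pi_lambda _ fun i => ?_)
      unfold truncate
      split_ifs <;> fun_prop
    exact h.indepFun_interarrival_marks.comp hφ measurable_id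

/-- Compensation of the number of arrivals: the chance that the next arrival comes before the
current horizon is the mean time spent between the last arrival and the horizon. -/
lemma measure_arrivalTime_le_horizon (h : IsMarkedPoisson Γ W P V P₀) [IsProbabilityMeasure P]
    (d : ℕ → K) (τ : ℝ≥0) (n : ℕ) :
    P {ω | arrivalTime (waiting Γ ω) (n + 1) ≤ horizon d τ (waiting Γ ω) (fun j => W j ω) n} =
      ∫⁻ ω, (min (arrivalTime (waiting Γ ω) (n + 1))
        (horizon d τ (waiting Γ ω) (fun j => W j ω) n) - arrivalTime (waiting Γ ω) n) ∂P := by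
  set Y : Ω → (ℕ → ℝ≥0∞) × (ℕ → K → ℝ≥0) :=
    fun ω => (truncate n (waiting Γ ω), fun j => W j ω) with hYdef
  have hX := h.arrivals.measurable_interarrival n
  have hY : Measurable Y := by
    refine Measurable.prodMk (measurable_pi_lambda _ fun i => ?_) h.measurable_marks
    unfold truncate
    split_ifs
    · exact (h.arrivals.measurable_interarrival i).ennreal_ofReal
    · exact measurable_const
  let A : (ℕ → ℝ≥0∞) × (ℕ → K → ℝ≥0) → ℝ≥0∞ := fun p => arrivalTime p.1 n
  let R : (ℕ → ℝ≥0∞) × (ℕ → K → ℝ≥0) → ℝ≥0∞ := fun p => horizon d τ p.1 p.2 n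
  have hA : Measurable A := measurable_arrivalTime measurable_fst n
  have hR : Measurable R := measurable_horizon d τ measurable_fst measurable_snd n
  have hAω : ∀ ω, arrivalTime (waiting Γ ω) n = A (Y ω) := fun ω =>
    (arrivalTime_truncate le_rfl _).symm
  have hRω : ∀ ω, horizon d τ (waiting Γ ω) (fun j => W j ω) n = R (Y ω) := fun ω =>
    (horizon_truncate d τ n _ _).symm
  have hGω : ∀ ω, arrivalTime (waiting Γ ω) (n + 1) =
      A (Y ω) + ENNReal.ofReal (interarrival Γ n ω) := fun ω => by
    rw [arrivalTime_succ, hAω]; rfl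
  simp_rw [hRω, hGω, hAω]
  have hind := (indepFun_iff_map_prod_eq_prod_map_map hX.aemeasurable hY.aemeasurable).1
    (h.indepFun_waiting_past n)
  rw [(h.arrivals.law n).map_eq] at hind
  have := Measure.isProbabilityMeasure_map (μ := P) hY.aemeasurable
  have hXY : Measurable fun ω => (interarrival Γ n ω, Y ω) := hX.prodMk hY
  have hS : MeasurableSet {p : ℝ × ((ℕ → ℝ≥0∞) × (ℕ → K → ℝ≥0)) |
      A p.2 + ENNReal.ofReal p.1 ≤ R p.2} :=
    measurableSet_le ((hA.comp measurable_snd).add measurable_fst.ennreal_ofReal)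
      (hR.comp measurable_snd)
  have hf : Measurable fun p : ℝ × ((ℕ → ℝ≥0∞) × (ℕ → K → ℝ≥0)) =>
      min (A p.2 + ENNReal.ofReal p.1) (R p.2) - A p.2 :=
    (((hA.comp measurable_snd).add measurable_fst.ennreal_ofReal).min
      (hR.comp measurable_snd)).sub (hA.comp measurable_snd)
  have hAfin : ∀ᵐ y ∂(P.map Y), A y ≠ ∞ := by
    refine (ae_map_iff (p := fun y => A y ≠ ∞) hY.aemeasurable
      (hA (measurableSet_singleton ∞).compl)).2 ?_
    refine Filter.Eventually.of_forall fun ω => ?_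
    rw [← hAω]
    exact arrivalTime_ne_top (fun i => ENNReal.ofReal_ne_top) n
  calc P {ω | A (Y ω) + ENNReal.ofReal (interarrival Γ n ω) ≤ R (Y ω)}
      = (P.map fun ω => (interarrival Γ n ω, Y ω)) {p | A p.2 + ENNReal.ofReal p.1 ≤ R p.2} := by
        rw [Measure.map_apply hXY hS]; rfl
    -- With the past `y` frozen, only the exponential waiting time is random, and
    -- `expMeasure_one_add_le` applies.
    _ = ∫⁻ y, expMeasure 1 {x | A y + ENNReal.ofReal x ≤ R y} ∂(P.map Y) := by
        rw [hind, Measure.prod_apply_symm hS]; rfl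
    _ = ∫⁻ y, ∫⁻ x, (min (A y + ENNReal.ofReal x) (R y) - A y) ∂expMeasure 1 ∂(P.map Y) := by
        refine lintegral_congr_ae ?_
        filter_upwards [hAfin] with y hy
        exact expMeasure_one_add_le hy
    _ = ∫⁻ p, (min (A p.2 + ENNReal.ofReal p.1) (R p.2) - A p.2)
          ∂(P.map fun ω => (interarrival Γ n ω, Y ω)) := by
        rw [hind, lintegral_prod_symm' _ hf]
    _ = _ := lintegral_map hf hXY

end IsMarkedPoisson

/-! ### Prescribed arrivals and marks; the mean horizon. -/

lemma IsUnitPoissonArrivals.measure_arrivals_near_ne_zero {Γ : ℕ → Ω → ℝ} {P : Measure Ω}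
    (h : IsUnitPoissonArrivals Γ P) (m : ℕ) {s : ℕ → ℝ} (hs0 : 0 ≤ s 0)
    (hs : ∀ i, i + 1 < m → s i ≤ s (i + 1)) {δ : ℝ} (hδ : 0 < δ) :
    P {ω | ∀ i < m, Γ i ω ∈ Set.Ioo (s i) (s i + δ)} ≠ 0 := by
  -- The increments of `s`. Waiting times within `δ / (m + 1)` above them suffice, since at most `m`
  -- errors accumulate.
  set c : ℕ → ℝ := fun i => interarrival (fun j (_ : Unit) => s j) i () with hc
  have hcs : ∀ j, ∑ i ∈ Finset.range (j + 1), c i = s j := fun j =>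
    sum_interarrival (fun j (_ : Unit) => s j) j ()
  have hc0 : ∀ i < m, 0 ≤ c i := fun i hi => by
    cases i with
    | zero => exact hs0
    | succ i => exact sub_nonneg.2 (hs i hi)
  have hη : 0 < δ / (m + 1) := by positivity
  have hpos : P (⋂ i ∈ Finset.range m,
      interarrival Γ i ⁻¹' Set.Ioo (c i) (c i + δ / (m + 1))) ≠ 0 := by
    rw [h.indep.measure_inter_preimage_eq_mul _ fun i _ => measurableSet_Ioo]
    refine Finset.prod_ne_zero_iff.2 fun i hi => ?_
    rw [h.measure_waiting_mem i measurableSet_Ioo]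
    exact expMeasure_one_Ioo_ne_zero (hc0 i (Finset.mem_range.1 hi)) (by linarith)
  refine fun h0 => hpos (measure_mono_null ?_ h0)
  intro ω hω i hi
  simp only [Set.mem_iInter, Finset.mem_range] at hω
  have hmem : ∀ j ∈ Finset.range (i + 1),
      interarrival Γ j ω ∈ Set.Ioo (c j) (c j + δ / (m + 1)) := fun j hj =>
    hω j ((Nat.lt_succ_iff.1 (Finset.mem_range.1 hj)).trans_lt hi)
  rw [← sum_interarrival Γ i ω, ← hcs i]
  refine ⟨Finset.sum_lt_sum_of_nonempty (by simp) fun j hj => (hmem j hj).1, ?_⟩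
  calc ∑ j ∈ Finset.range (i + 1), interarrival Γ j ω
      < ∑ j ∈ Finset.range (i + 1), (c j + δ / (m + 1)) :=
        Finset.sum_lt_sum_of_nonempty (by simp) fun j hj => (hmem j hj).2
    _ = ∑ j ∈ Finset.range (i + 1), c j + (i + 1 : ℝ) * (δ / (m + 1)) := by
        rw [Finset.sum_add_distrib, Finset.sum_const, Finset.card_range]
        simp
    _ ≤ ∑ j ∈ Finset.range (i + 1), c j + δ := by
        gcongr
        rw [mul_div_assoc', div_le_iff₀ (by positivity), mul_comm]
        have : (i : ℝ) ≤ m := by exact_mod_cast hi.le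
        gcongr

namespace IsMarkedPoisson

variable [TopologicalSpace K] {Γ : ℕ → Ω → ℝ} {W : ℕ → Ω → K → ℝ≥0} {P : Measure Ω}
  {V : Ω₀ → K → ℝ≥0} {P₀ : Measure Ω₀}

lemma measure_marks_mem (h : IsMarkedPoisson Γ W P V P₀) (m : ℕ) {E : ℕ → Set (K → ℝ≥0)}
    (hE : ∀ i < m, MeasurableSet (E i)) :
    P {ω | ∀ i < m, W i ω ∈ E i} = ∏ i ∈ Finset.range m, P₀ (V ⁻¹' E i) := by
  have h1 := h.indep_marks.measure_inter_preimage_eq_mul (Finset.range m) (sets := E)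
    fun i hi => hE i (Finset.mem_range.1 hi)
  rw [Finset.prod_congr rfl fun i hi => (h.identDistrib i).measure_mem_eq
    (hE i (Finset.mem_range.1 hi))] at h1
  rw [← h1]
  congr 1
  ext ω
  simp

/-- Finitely many kinds of marks occur, with positive probability, as the first marks, at times
in prescribed intervals. -/
lemma exists_perm_measure_ne_zero (h : IsMarkedPoisson Γ W P V P₀) {m : ℕ}
    {l r : Fin m → ℝ≥0} (hlr : ∀ i, l i < r i) {E : Fin m → Set (K → ℝ≥0)}
    (hE : ∀ i, MeasurableSet (E i)) (hE0 : ∀ i, P₀ (V ⁻¹' E i) ≠ 0) :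
    ∃ σ : Equiv.Perm (Fin m), P {ω | ∀ i : Fin m, W i ω ∈ E (σ i) ∧
      Γ i ω ∈ Set.Ioo (l (σ i) : ℝ) (r (σ i))} ≠ 0 := by
  classical
  -- With `δ` at most half of every length, the window of width `δ` above a midpoint stays inside
  -- its interval. Sorting the midpoints makes the target times monotone.
  obtain ⟨δ, hδ, hδ0⟩ : ∃ δ : ℝ, (∀ i, δ ≤ ((r i : ℝ) - l i) / 2) ∧ 0 < δ := by
    have h1 : ∀ᶠ δ in nhdsWithin (0 : ℝ) (Set.Ioi 0), ∀ i, δ ≤ ((r i : ℝ) - l i) / 2 := by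
      refine Filter.eventually_all.2 fun i => ?_
      have : (0 : ℝ) < ((r i : ℝ) - l i) / 2 := by
        have : (l i : ℝ) < r i := hlr i
        linarith
      filter_upwards [Ioc_mem_nhdsGT this] with δ hδ using hδ.2
    obtain ⟨δ, hδ⟩ := (h1.and self_mem_nhdsWithin).exists
    exact ⟨δ, hδ.1, hδ.2⟩
  set c : Fin m → ℝ := fun i => ((l i : ℝ) + r i) / 2 with hc
  set σ := Tuple.sort c with hσ
  have hmono : Monotone (c ∘ σ) := Tuple.monotone_sort c
  refine ⟨σ, ?_⟩
  set s : ℕ → ℝ := fun i => if hi : i < m then c (σ ⟨i, hi⟩) else 0 with hs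
  have hs0 : 0 ≤ s 0 := by
    simp only [hs, hc]
    split_ifs
    · positivity
    · exact le_rfl
  have hsm : ∀ i, i + 1 < m → s i ≤ s (i + 1) := fun i hi => by
    simp only [hs, dif_pos hi, dif_pos (i.lt_succ_self.trans hi)]
    exact hmono (by simp)
  set E' : ℕ → Set (K → ℝ≥0) := fun i => if hi : i < m then E (σ ⟨i, hi⟩) else Set.univ with hE'
  have hE'm : ∀ i < m, MeasurableSet (E' i) := fun i hi => by
    simp only [hE', dif_pos hi]
    exact hE _
  have hmarks : P {ω | ∀ i < m, W i ω ∈ E' i} ≠ 0 := by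
    rw [h.measure_marks_mem m hE'm]
    refine Finset.prod_ne_zero_iff.2 fun i hi => ?_
    simp only [hE', dif_pos (Finset.mem_range.1 hi)]
    exact hE0 _
  have harr := h.arrivals.measure_arrivals_near_ne_zero m hs0 hsm hδ0
  have hmA : MeasurableSet {g : ℕ → ℝ | ∀ i < m, g i ∈ Set.Ioo (s i) (s i + δ)} := by
    have : {g : ℕ → ℝ | ∀ i < m, g i ∈ Set.Ioo (s i) (s i + δ)} =
        ⋂ i < m, (fun g => g i) ⁻¹' Set.Ioo (s i) (s i + δ) := by ext; simp
    rw [this]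
    exact MeasurableSet.iInter fun i => MeasurableSet.iInter fun _ =>
      measurable_pi_apply i measurableSet_Ioo
  have hmB : MeasurableSet {v : ℕ → K → ℝ≥0 | ∀ i < m, v i ∈ E' i} := by
    have : {v : ℕ → K → ℝ≥0 | ∀ i < m, v i ∈ E' i} = ⋂ i < m, (fun v => v i) ⁻¹' E' i := by
      ext; simp
    rw [this]
    exact MeasurableSet.iInter fun i => MeasurableSet.iInter fun hi =>
      measurable_pi_apply i (hE'm i hi)
  have hprod := h.indep_arrivals_marks.measure_inter_preimage_eq_mul _ _ hmA hmB
  have hne : P ((fun ω j => Γ j ω) ⁻¹' {g : ℕ → ℝ | ∀ i < m, g i ∈ Set.Ioo (s i) (s i + δ)} ∩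
      (fun ω j => W j ω) ⁻¹' {v : ℕ → K → ℝ≥0 | ∀ i < m, v i ∈ E' i}) ≠ 0 := by
    rw [hprod]
    exact mul_ne_zero harr hmarks
  refine fun h0 => hne (measure_mono_null ?_ h0)
  intro ω hω i
  have h1 := hω.1 i i.2
  have h2 := hω.2 i i.2
  simp only [hs, hE', dif_pos i.2] at h1 h2
  refine ⟨h2, ?_, ?_⟩
  · have := hδ (σ i)
    have := h1.1
    have : (l (σ i) : ℝ) < r (σ i) := hlr (σ i)
    simp only [hc, Fin.eta] at *
    linarith
  · have := hδ (σ i)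
    have := h1.2
    simp only [hc, Fin.eta] at *
    linarith

/-- The mean horizon is finite if finitely many kinds of marks, each of positive probability,
keep the process away from zero. -/
lemma lintegral_horizon_top_ne_top (h : IsMarkedPoisson Γ W P V P₀) [IsProbabilityMeasure P]
    [IsProbabilityMeasure P₀] (d : ℕ → K) (τ : ℝ≥0) {m : ℕ}
    {U : Fin m → Set K} {r : Fin m → ℝ≥0} (hr0 : ∀ i, 0 < r i) (hU : ∀ k, ∃ i, d k ∈ U i)
    {E : Fin m → Set (K → ℝ≥0)} (hEm : ∀ i, MeasurableSet (E i))
    (hE0 : ∀ i, P₀ (V ⁻¹' E i) ≠ 0)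
    (hE : ∀ i, ∀ f ∈ E i, ∀ k, d k ∈ U i → r i ≤ f (d k)) :
    ∫⁻ ω, horizon d τ (waiting Γ ω) (fun j => W j ω) ⊤ ∂P ≠ ∞ := by
  have hV : AEMeasurable V P₀ := (h.identDistrib 0).aemeasurable_snd
  have hmB : ∀ i j, MeasurableSet {v : ℕ → K → ℝ≥0 | ∀ k < j, v k ∈ (E i)ᶜ} := fun i j => by
    have : {v : ℕ → K → ℝ≥0 | ∀ k < j, v k ∈ (E i)ᶜ} = ⋂ k < j, (fun v => v k) ⁻¹' (E i)ᶜ := by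
      ext; simp
    rw [this]
    exact MeasurableSet.iInter fun k => MeasurableSet.iInter fun _ =>
      measurable_pi_apply k (hEm i).compl
  have hme : ∀ j, Measurable fun ω => waiting Γ ω j := fun j =>
    (h.arrivals.measurable_interarrival j).ennreal_ofReal
  have hmI : ∀ i j, Measurable fun ω =>
      {v : ℕ → K → ℝ≥0 | ∀ k < j, v k ∈ (E i)ᶜ}.indicator (1 : (ℕ → K → ℝ≥0) → ℝ≥0∞) fun k => W k ω :=
    fun i j => (measurable_one.indicator (hmB i j)).comp h.measurable_marks
  -- By independence: mean waiting time one, times the chance that the first `j` marks all miss `E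
  -- i`. The resulting geometric series converges as `E i` has positive probability.
  have hterm : ∀ i j, ∫⁻ ω, waiting Γ ω j *
      {v : ℕ → K → ℝ≥0 | ∀ k < j, v k ∈ (E i)ᶜ}.indicator 1 (fun k => W k ω) ∂P =
      P₀ (V ⁻¹' (E i)ᶜ) ^ j := fun i j => by
    have hind : IndepFun (fun ω => waiting Γ ω j) (fun ω =>
        {v : ℕ → K → ℝ≥0 | ∀ k < j, v k ∈ (E i)ᶜ}.indicator (1 : (ℕ → K → ℝ≥0) → ℝ≥0∞) fun k => W k ω) P :=
      h.indepFun_interarrival_marks.comp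
        (φ := fun g : ℕ → ℝ => ENNReal.ofReal (g j)) (ENNReal.measurable_ofReal.comp (measurable_pi_apply j))
        (measurable_one.indicator (hmB i j))
    rw [lintegral_mul_eq_lintegral_mul_lintegral_of_indepFun'' (hme j).aemeasurable
      (hmI i j).aemeasurable hind, h.arrivals.lintegral_waiting, one_mul]
    have h1 := h.measure_marks_mem j (E := fun _ => (E i)ᶜ) fun _ _ => (hEm i).compl
    rw [Finset.prod_const, Finset.card_range] at h1
    rw [← h1, ← lintegral_indicator_one]
    · rfl
    · exact h.measurable_marks (hmB i j)
  have hmT : ∀ i j, Measurable fun ω => waiting Γ ω j *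
      {v : ℕ → K → ℝ≥0 | ∀ k < j, v k ∈ (E i)ᶜ}.indicator 1 fun k => W k ω := fun i j =>
    (hme j).mul (hmI i j)
  have hmS : ∀ i, Measurable fun ω => ∑' j : ℕ, waiting Γ ω j *
      {v : ℕ → K → ℝ≥0 | ∀ k < j, v k ∈ (E i)ᶜ}.indicator 1 fun k => W k ω := fun i =>
    Measurable.tsum (hmT i)
  have hbound : ∀ᵐ ω ∂P, horizon d τ (waiting Γ ω) (fun j => W j ω) ⊤ ≤
      ∑ i, (τ / r i : ℝ≥0∞) * ∑' j : ℕ, waiting Γ ω j *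
        {v : ℕ → K → ℝ≥0 | ∀ k < j, v k ∈ (E i)ᶜ}.indicator 1 fun k => W k ω := by
    filter_upwards [h.arrivals.ae_tsum_waiting, h.arrivals.ae_waiting_ne_zero] with ω h1 h2
    exact horizon_top_le_sum_waiting d τ h1 h2 (fun i => ENNReal.ofReal_ne_top) _ hr0 hU hE
  refine ne_top_of_le_ne_top ?_ (lintegral_mono_ae hbound)
  rw [lintegral_finsetSum _ fun i _ => (hmS i).const_mul _]
  refine ENNReal.sum_ne_top.2 fun i _ => ?_
  rw [lintegral_const_mul _ (hmS i), lintegral_tsum fun j => (hmT i j).aemeasurable]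
  simp_rw [hterm, ENNReal.tsum_geometric]
  refine ENNReal.mul_ne_top (ENNReal.div_ne_top ENNReal.coe_ne_top ?_) (ENNReal.inv_ne_top.2 ?_)
  · exact_mod_cast (hr0 i).ne'
  · rw [Set.preimage_compl]
    refine (tsub_pos_of_lt (lt_of_le_of_ne prob_le_one fun h1 => hE0 i ?_)).ne'
    exact (prob_compl_eq_one_iff₀ (hV.nullMeasurable (hEm i))).1 h1

end IsMarkedPoisson

/-! ### Finite covers by neighbourhoods with large marks. -/

/-- The functions at which `y` is at most `l` and which are at least `r` at the sites in `U`. -/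
def largeOn (d : ℕ → K) (y : (K → ℝ≥0) → ℝ≥0) (U : Set K) (l r : ℝ≥0) : Set (K → ℝ≥0) :=
  {f | y f ≤ l ∧ ∀ k, d k ∈ U → r ≤ f (d k)}

lemma measurableSet_largeOn (d : ℕ → K) {y : (K → ℝ≥0) → ℝ≥0} (hy : Measurable y) (U : Set K)
    (l r : ℝ≥0) : MeasurableSet (largeOn d y U l r) := by
  have : largeOn d y U l r = {f | y f ≤ l} ∩ ⋂ (k) (_ : d k ∈ U), {f | r ≤ f (d k)} := by
    ext f
    simp [largeOn]
  rw [this]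
  exact (measurableSet_le hy measurable_const).inter (MeasurableSet.iInter fun k =>
    MeasurableSet.iInter fun _ => measurableSet_le measurable_const (measurable_pi_apply _))

/-- By path continuity the event is covered by countably many events, indexed by basic
neighbourhoods and pairs from a countable dense set; not all of them can be null. -/
lemma exists_nhds_measure_largeOn_ne_zero [TopologicalSpace K] [FirstCountableTopology K]
    {P₀ : Measure Ω₀}
    {V : Ω₀ → K → ℝ≥0} (hV : ∀ ω, Continuous (V ω)) (d : ℕ → K) (y : (K → ℝ≥0) → ℝ≥0) (x : K)
    (h : P₀ {ω | y (V ω) < V ω x} ≠ 0) :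
    ∃ U ∈ nhds x, ∃ l r : ℝ≥0, l < r ∧ P₀ (V ⁻¹' largeOn d y U l r) ≠ 0 := by
  obtain ⟨B, hB⟩ := (nhds x).exists_antitone_basis
  set q := TopologicalSpace.denseSeq ℝ≥0
  have hq : Dense (Set.range q) := TopologicalSpace.denseRange_denseSeq _
  by_contra! hno
  refine h (measure_mono_null (t := ⋃ (n : ℕ) (a : ℕ) (b : ℕ) (_ : q a < q b),
    V ⁻¹' largeOn d y (B n) (q a) (q b)) (fun ω hω => ?_) ?_)
  · obtain ⟨_, ⟨a, rfl⟩, ha, ha'⟩ := hq.exists_between hω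
    obtain ⟨_, ⟨b, rfl⟩, hb, hb'⟩ := hq.exists_between ha'
    have hev : ∀ᶠ z in nhds x, q b < V ω z :=
      (hV ω).continuousAt.eventually (lt_mem_nhds hb')
    obtain ⟨n, -, hn⟩ := hB.toHasBasis.mem_iff.1 hev
    simp only [Set.mem_iUnion]
    exact ⟨n, a, b, hb, ha.le, fun k hk => (hn hk).le⟩
  · simp only [measure_iUnion_null_iff]
    exact fun n a b hab => hno _ (hB.mem n) _ _ hab

lemma exists_cover_measure_largeOn_ne_zero [TopologicalSpace K] [FirstCountableTopology K]
    [CompactSpace K] {P₀ : Measure Ω₀}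
    {V : Ω₀ → K → ℝ≥0} (hV : ∀ ω, Continuous (V ω)) (d : ℕ → K) (y : (K → ℝ≥0) → ℝ≥0)
    (h : ∀ x, P₀ {ω | y (V ω) < V ω x} ≠ 0) :
    ∃ (m : ℕ) (U : Fin m → Set K) (l r : Fin m → ℝ≥0), (∀ i, l i < r i) ∧ (∀ x, ∃ i, x ∈ U i) ∧
      ∀ i, P₀ (V ⁻¹' largeOn d y (U i) (l i) (r i)) ≠ 0 := by
  choose U hU l r hlr hP using fun x => exists_nhds_measure_largeOn_ne_zero hV d y x (h x)
  obtain ⟨t, -, ht⟩ := isCompact_univ.elim_nhds_subcover U fun x _ => hU x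
  set c := fun i : Fin t.card => (t.equivFin.symm i : K)
  refine ⟨t.card, U ∘ c, l ∘ c, r ∘ c, fun i => hlr _, fun x => ?_, fun i => hP _⟩
  obtain ⟨z, hz, hxz⟩ := Set.mem_iUnion₂.1 (ht (Set.mem_univ x))
  exact ⟨t.equivFin ⟨z, hz⟩, by simpa [c] using hxz⟩

/-- A spectral process exceeds its truncation at any other site with positive probability. -/
lemma IsSpectralProcess.measure_min_lt_ne_zero [TopologicalSpace K] {V : Ω₀ → K → ℝ≥0}
    {P₀ : Measure Ω₀} (hV : IsSpectralProcess V P₀) {τ : ℝ≥0} {x₀ : K}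
    (h : P₀ {ω | τ < V ω x₀} ≠ 0) (x : K) : P₀ {ω | min (V ω x₀) τ < V ω x} ≠ 0 := by
  intro h0
  have hle : ∀ᵐ ω ∂P₀, V ω x ≤ min (V ω x₀) τ := by
    simpa only [ae_iff, not_le] using h0
  have hm : ∀ x, Measurable fun ω => (V ω x : ℝ≥0∞) := fun x =>
    (hV.sampleContinuous.measurable x).coe_nnreal_ennreal
  -- Equal means at `x` and `x₀` leave truncation no room to lower the mean at `x₀`, so `V ω x₀ ≤ τ`
  -- almost surely, contrary to assumption.
  have h1 : ∫⁻ ω, (V ω x₀ : ℝ≥0∞) ∂P₀ ≤ ∫⁻ ω, ((min (V ω x₀) τ : ℝ≥0) : ℝ≥0∞) ∂P₀ := by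
    rw [hV.mean_one x₀, ← hV.mean_one x]
    refine lintegral_mono_ae ?_
    filter_upwards [hle] with ω hω using by exact_mod_cast hω
  have h2 := ae_eq_of_ae_le_of_lintegral_le (f := fun ω => ((min (V ω x₀) τ : ℝ≥0) : ℝ≥0∞))
    (g := fun ω => (V ω x₀ : ℝ≥0∞)) (μ := P₀)
    (Filter.Eventually.of_forall fun ω => ENNReal.coe_le_coe.2 (min_le_left _ _))
    (ne_top_of_le_ne_top ENNReal.one_ne_top (by
      rw [← hV.mean_one x₀]
      exact lintegral_mono fun ω => ENNReal.coe_le_coe.2 (min_le_left _ _)))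
    (hm x₀).aemeasurable h1
  refine h ?_
  have h3 : ∀ᵐ ω ∂P₀, V ω x₀ ≤ τ := by
    filter_upwards [h2] with ω hω
    have : min (V ω x₀) τ = V ω x₀ := by exact_mod_cast hω
    exact min_eq_left_iff.1 this
  simpa only [ae_iff, not_le] using h3

lemma IsSpectralProcess.measure_zero_lt_ne_zero [TopologicalSpace K] {V : Ω₀ → K → ℝ≥0}
    {P₀ : Measure Ω₀} (hV : IsSpectralProcess V P₀) (x : K) : P₀ {ω | 0 < V ω x} ≠ 0 := by
  intro h0
  have h1 : ∀ᵐ ω ∂P₀, (V ω x : ℝ≥0∞) = 0 := by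
    have : ∀ᵐ ω ∂P₀, ¬ 0 < V ω x := by simpa only [ae_iff, not_not] using h0
    filter_upwards [this] with ω hω
    exact_mod_cast le_antisymm (not_lt.1 hω) zero_le
  have h2 := hV.mean_one x
  rw [lintegral_congr_ae h1, lintegral_zero] at h2
  exact zero_ne_one h2

namespace IsMarkedPoisson

variable [TopologicalSpace K] {Γ : ℕ → Ω → ℝ} {W : ℕ → Ω → K → ℝ≥0} {P : Measure Ω}
  {V : Ω₀ → K → ℝ≥0} {P₀ : Measure Ω₀}

lemma lintegral_horizon_ne_top [FirstCountableTopology K] [CompactSpace K]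
    (h : IsMarkedPoisson Γ W P V P₀) [IsProbabilityMeasure P]
    [IsProbabilityMeasure P₀] (hV : IsSpectralProcess V P₀) (d : ℕ → K) (τ : ℝ≥0) :
    ∫⁻ ω, horizon d τ (waiting Γ ω) (fun j => W j ω) ⊤ ∂P ≠ ∞ := by
  obtain ⟨m, U, l, r, hlr, hU, hP⟩ := exists_cover_measure_largeOn_ne_zero (P₀ := P₀)
    hV.sampleContinuous.continuous d (fun _ => 0) hV.measure_zero_lt_ne_zero
  exact h.lintegral_horizon_top_ne_top d τ (fun i => (hlr i).bot_lt) (fun k => hU _)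
    (fun i => measurableSet_largeOn d measurable_const _ _ _) hP fun i f hf => hf.2

/-- If the spectral process exceeds `τ` at a site with positive probability, then the time spent
below the running horizons exceeds the final horizon with positive probability. -/
lemma not_ae_tsum_eq_horizon [FirstCountableTopology K] [CompactSpace K]
    (h : IsMarkedPoisson Γ W P V P₀) [IsProbabilityMeasure P]
    (hV : IsSpectralProcess V P₀) (d : ℕ → K) {τ : ℝ≥0} (hτ : 0 < τ) {k₀ : ℕ}
    (hk₀ : P₀ {ω | τ < V ω (d k₀)} ≠ 0) :
    ¬ ∀ᵐ ω ∂P, ∑' n : ℕ, (min (arrivalTime (waiting Γ ω) (n + 1))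
        (horizon d τ (waiting Γ ω) (fun j => W j ω) n) - arrivalTime (waiting Γ ω) n) =
      horizon d τ (waiting Γ ω) (fun j => W j ω) ⊤ := by
  intro hae
  obtain ⟨m, U, l, r, hlr, hU, hP⟩ := exists_cover_measure_largeOn_ne_zero
    hV.sampleContinuous.continuous d (fun f => min (f (d k₀)) τ) (hV.measure_min_lt_ne_zero hk₀)
  obtain ⟨σ, hσ⟩ := h.exists_perm_measure_ne_zero hlr (fun i => measurableSet_largeOn d
    ((measurable_pi_apply _).min measurable_const) _ _ _) hP
  refine hσ ?_
  rw [measure_eq_zero_iff_ae_notMem]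
  filter_upwards [hae, h.arrivals.ae_tsum_waiting, h.arrivals.ae_waiting_ne_zero,
    h.arrivals.ae_ofReal_eq_arrivalTime] with ω h1 h2 h3 h4 h5
  refine absurd h1 (ne_of_gt ?_)
  refine horizon_top_lt_tsum d hτ h2 h3 (fun i => ENNReal.ofReal_ne_top) (U := U ∘ σ)
    (l := l ∘ σ) (r := r ∘ σ) (fun k => ?_) k₀ (fun i => (h5 i).1.1) (fun i => (h5 i).1.2)
    (fun i => ?_) (fun i => ?_)
  · obtain ⟨i, hi⟩ := hU (d k)
    exact ⟨σ.symm i, by simpa using hi⟩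
  · rw [← h4, ← ENNReal.ofReal_coe_nnreal]
    exact (ENNReal.ofReal_lt_ofReal_iff_of_nonneg (NNReal.coe_nonneg _)).2 (h5 i).2.1
  · have h6 := (h5 i).2
    rw [← h4, ← ENNReal.ofReal_coe_nnreal]
    exact (ENNReal.ofReal_lt_ofReal_iff_of_nonneg
      ((NNReal.coe_nonneg _).trans h6.1.le)).2 h6.2

end IsMarkedPoisson

/-! ### The stopping time, its mean, and exactness. -/

lemma partialMax_eq_runningMax {α : Type*} {Γ : ℕ → α → ℝ} {W : ℕ → α → K → ℝ≥0} {ω : α}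
    {e : ℕ → ℝ≥0∞} (h : ∀ j, ENNReal.ofReal (Γ j ω) = arrivalTime e (j + 1)) (n : ℕ∞) (x : K) :
    partialMax Γ W n ω x = runningMax e (fun j => W j ω) n x :=
  iSup_congr fun j => iSup_congr fun _ => by rw [h]

lemma continuous_runningMax [TopologicalSpace K] {e : ℕ → ℝ≥0∞} (he0 : ∀ i, e i ≠ 0)
    {w : ℕ → K → ℝ≥0} (hw : ∀ j, Continuous (w j)) (n : ℕ) :
    Continuous fun x => runningMax e w n x := by
  have heq : (fun x => runningMax e w n x) = fun x =>
      (Finset.range n).sup fun j => (w j x : ℝ≥0∞) / arrivalTime e (j + 1) := by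
    ext x
    simp [runningMax, Finset.sup_eq_iSup]
  rw [heq]
  exact Continuous.finset_sup_apply fun j _ =>
    (ENNReal.continuous_div_const _ (arrivalTime_succ_ne_zero he0 j)).comp
    (ENNReal.continuous_coe.comp (hw j))

lemma iInf_eq_iInf_of_denseRange [TopologicalSpace K] {d : ℕ → K} (hd : DenseRange d)
    {f : K → ℝ≥0∞} (hf : Continuous f) : ⨅ x, f x = ⨅ k, f (d k) := by
  rw [← Dense.ciInf hd hf (OrderBot.bddBelow _), iInf_range']

lemma forall_le_of_denseRange [TopologicalSpace K] {d : ℕ → K} (hd : DenseRange d)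
    {f : K → ℝ≥0} (hf : Continuous f) {τ : ℝ≥0} (h : ∀ k, f (d k) ≤ τ) (x : K) : f x ≤ τ :=
  hd.induction_on (p := fun x => f x ≤ τ) x (isClosed_le hf continuous_const) h

namespace IsMarkedPoisson

variable [TopologicalSpace K] {Γ : ℕ → Ω → ℝ} {W : ℕ → Ω → K → ℝ≥0} {P : Measure Ω}
  {V : Ω₀ → K → ℝ≥0} {P₀ : Measure Ω₀}

lemma ae_stoppingTime_eq_tsum (h : IsMarkedPoisson Γ W P V P₀) {d : ℕ → K} (hd : DenseRange d)
    {τ : ℝ≥0} (hτ : 0 < τ) :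
    ∀ᵐ ω ∂P, (stoppingTime Γ W τ ω : ℝ≥0∞) = ∑' n : ℕ,
      {n : ℕ | arrivalTime (waiting Γ ω) (n + 1) ≤
        horizon d τ (waiting Γ ω) (fun j => W j ω) n}.indicator (1 : ℕ → ℝ≥0∞) n := by
  filter_upwards [h.arrivals.ae_waiting_ne_zero, h.arrivals.ae_ofReal_eq_arrivalTime]
    with ω h0 hΓ
  have hτ0 : (τ : ℝ≥0∞) ≠ 0 := by exact_mod_cast hτ.ne'
  rw [← coe_iInf_one_le_and_not_eq_tsum]
  · congr 1
    refine iInf_congr fun n => iInf_congr_Prop (and_congr_right fun _ => ?_) fun _ => rfl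
    have h1 : ⨅ x, partialMax Γ W n ω x =
        ⨅ k, runningMax (waiting Γ ω) (fun j => W j ω) n (d k) := by
      simp_rw [partialMax_eq_runningMax hΓ]
      exact iInf_eq_iInf_of_denseRange hd (continuous_runningMax h0
        (fun j => (h.sampleContinuous j).continuous ω) n)
    rw [h1, hΓ]
    exact ENNReal_div_lt_iff_not_le_div hτ0 ENNReal.coe_ne_top (arrivalTime_succ_ne_zero h0 n)
      (arrivalTime_ne_top (fun i => ENNReal.ofReal_ne_top) _)
  · rw [Nat.cast_zero, horizon_zero d hτ]
    exact le_top
  · intro n hn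
    refine (arrivalTime_mono _ (Nat.le_succ _)).trans (hn.trans (horizon_antitone _ _ _ _ ?_))
    exact_mod_cast n.le_succ

/-- The mean stopping time is the mean time spent below the running horizons. -/
lemma lintegral_stoppingTime (h : IsMarkedPoisson Γ W P V P₀) [IsProbabilityMeasure P]
    {d : ℕ → K} (hd : DenseRange d) {τ : ℝ≥0} (hτ : 0 < τ) :
    ∫⁻ ω, (stoppingTime Γ W τ ω : ℝ≥0∞) ∂P =
      ∫⁻ ω, ∑' n : ℕ, (min (arrivalTime (waiting Γ ω) (n + 1))
        (horizon d τ (waiting Γ ω) (fun j => W j ω) n) - arrivalTime (waiting Γ ω) n) ∂P := by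
  have hG := fun n => measurable_arrivalTime h.arrivals.measurable_waiting n
  have hH := fun n => measurable_horizon d τ h.arrivals.measurable_waiting h.measurable_marks n
  have hS : ∀ n : ℕ, MeasurableSet {ω | arrivalTime (waiting Γ ω) (n + 1) ≤
      horizon d τ (waiting Γ ω) (fun j => W j ω) n} := fun n => measurableSet_le (hG _) (hH _)
  have hD : ∀ n : ℕ, Measurable fun ω => min (arrivalTime (waiting Γ ω) (n + 1))
      (horizon d τ (waiting Γ ω) (fun j => W j ω) n) - arrivalTime (waiting Γ ω) n := fun n =>
    ((hG (n + 1)).min (hH n)).sub (hG n)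
  have hind : ∀ (n : ℕ) ω, {n : ℕ | arrivalTime (waiting Γ ω) (n + 1) ≤
      horizon d τ (waiting Γ ω) (fun j => W j ω) n}.indicator (1 : ℕ → ℝ≥0∞) n =
      {ω | arrivalTime (waiting Γ ω) (n + 1) ≤
        horizon d τ (waiting Γ ω) (fun j => W j ω) n}.indicator (1 : Ω → ℝ≥0∞) ω :=
    fun n ω => rfl
  rw [lintegral_congr_ae (h.ae_stoppingTime_eq_tsum hd hτ)]
  simp_rw [hind]
  rw [lintegral_tsum fun n => (measurable_one.indicator (hS n)).aemeasurable,
    lintegral_tsum fun n => (hD n).aemeasurable]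
  refine tsum_congr fun n => ?_
  rw [lintegral_indicator_one (hS n)]
  exact h.measure_arrivalTime_le_horizon d τ n

lemma ae_marks_le (h : IsMarkedPoisson Γ W P V P₀) {d : ℕ → K} (hd : DenseRange d) {τ : ℝ≥0}
    (hle : ∀ᵐ ω ∂P₀, ⨆ x, (V ω x : ℝ≥0∞) ≤ τ) : ∀ᵐ ω ∂P, ∀ j x, W j ω x ≤ τ := by
  have hS : MeasurableSet {f : K → ℝ≥0 | ∀ k, f (d k) ≤ τ} := by
    have : {f : K → ℝ≥0 | ∀ k, f (d k) ≤ τ} = ⋂ k, {f | f (d k) ≤ τ} := by ext; simp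
    rw [this]
    exact MeasurableSet.iInter fun k => measurableSet_le (measurable_pi_apply _) measurable_const
  have h1 : ∀ᵐ ω ∂P, ∀ j k, W j ω (d k) ≤ τ := by
    rw [ae_all_iff]
    refine fun j => (h.identDistrib j).symm.ae_snd hS ?_
    filter_upwards [hle] with ω hω k
    exact_mod_cast (le_iSup (fun x => (V ω x : ℝ≥0∞)) (d k)).trans hω
  filter_upwards [h1] with ω hω j
  exact forall_le_of_denseRange hd ((h.sampleContinuous j).continuous ω) (hω j)

/-- Threshold stopping is exact if the spectral process is bounded by the threshold. -/
lemma ae_stoppedMax_eq (h : IsMarkedPoisson Γ W P V P₀) {d : ℕ → K} (hd : DenseRange d)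
    {τ : ℝ≥0} (hle : ∀ᵐ ω ∂P₀, ⨆ x, (V ω x : ℝ≥0∞) ≤ τ) :
    ∀ᵐ ω ∂P, ∀ x, stoppedMax Γ W τ ω x = partialMax Γ W ⊤ ω x := by
  filter_upwards [h.ae_marks_le hd hle, h.arrivals.ae_ofReal_eq_arrivalTime] with ω hW hΓ x
  unfold stoppedMax
  -- If the algorithm never stops, its output is the full maximum by definition, so finiteness of
  -- the stopping time is not needed.
  rcases eq_or_ne (stoppingTime Γ W τ ω) ⊤ with htop | htop
  · rw [htop]
  obtain ⟨n, hn⟩ := ciInf_mem fun n : ℕ => ⨅ (_ : 1 ≤ n ∧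
    (τ : ℝ≥0∞) / ENNReal.ofReal (Γ n ω) < ⨅ x : K, partialMax Γ W n ω x), (n : ℕ∞)
  change _ = stoppingTime Γ W τ ω at hn
  by_cases hc : 1 ≤ n ∧ (τ : ℝ≥0∞) / ENNReal.ofReal (Γ n ω) < ⨅ x : K, partialMax Γ W n ω x
  swap
  · exact absurd (hn.symm.trans (iInf_neg hc)) htop
  have hn' : stoppingTime Γ W τ ω = n := hn.symm.trans (iInf_pos hc)
  rw [hn']
  refine le_antisymm ?_ (iSup₂_le fun j _ => ?_)
  · rw [partialMax_eq_runningMax hΓ, partialMax_eq_runningMax hΓ]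
    exact runningMax_mono _ _ x le_top
  · rcases lt_or_ge j n with hj | hj
    · exact le_iSup₂_of_le (f := fun (j : ℕ) (_ : (j : ℕ∞) < n) =>
        (W j ω x : ℝ≥0∞) / ENNReal.ofReal (Γ j ω)) j (by exact_mod_cast hj) le_rfl
    -- A mark not yet seen contributes at most `τ / Γ n`, which the stopping rule places below the
    -- current maximum.
    · refine le_trans ?_ (hc.2.le.trans (iInf_le _ x))
      refine ENNReal.div_le_div (by exact_mod_cast hW j x) ?_
      rw [hΓ, hΓ]
      exact arrivalTime_mono _ (Nat.succ_le_succ hj)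

end IsMarkedPoisson

/-- The mean of the reciprocal of the infimum of a simple max-stable process in terms of the
horizon. -/
lemma HasSpectralRepresentation.mul_lintegral_inv_iInf [TopologicalSpace K] {Ω' : Type*}
    [MeasurableSpace Ω'] {Γ : ℕ → Ω → ℝ} {W : ℕ → Ω → K → ℝ≥0} {P : Measure Ω}
    {Z : Ω' → K → ℝ≥0} {P' : Measure Ω'} (hZ : HasSpectralRepresentation Z P' Γ W P)
    (hΓ : IsUnitPoissonArrivals Γ P) {d : ℕ → K} (hd : DenseRange d) {τ : ℝ≥0} :
    (τ : ℝ≥0∞) * ∫⁻ ω', (⨅ x, (Z ω' x : ℝ≥0∞))⁻¹ ∂P' =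
      ∫⁻ ω, horizon d τ (waiting Γ ω) (fun j => W j ω) ⊤ ∂P := by
  have hφ : Measurable fun f : K → ℝ≥0∞ => (⨅ k, f (d k))⁻¹ :=
    (Measurable.iInf fun k => measurable_pi_apply (d k)).inv
  -- The law is transferred with the infimum over the dense sequence, which is measurable on the
  -- product space. Only `Z` then needs continuity to recover the infimum over `K`.
  have h1 := (hZ.identDistrib.comp hφ).lintegral_eq
  have h2 : ∀ ω', (⨅ x, (Z ω' x : ℝ≥0∞)) = ⨅ k, (Z ω' (d k) : ℝ≥0∞) := fun ω' =>
    iInf_eq_iInf_of_denseRange hd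
      (ENNReal.continuous_coe.comp (hZ.sampleContinuous.continuous ω'))
  simp_rw [h2]
  change ∫⁻ ω', (⨅ k, (Z ω' (d k) : ℝ≥0∞))⁻¹ ∂P' = _ at h1
  rw [h1, ← lintegral_const_mul' _ _ ENNReal.coe_ne_top]
  refine lintegral_congr_ae ?_
  filter_upwards [hΓ.ae_ofReal_eq_arrivalTime] with ω hω
  simp only [Function.comp, horizon, div_eq_mul_inv, partialMax_eq_runningMax hω]

end MaxStable

end

/-! ### The theorem. -/

theorem mainTheorem1 {K Ω₀ Ω Ω' : Type*} [MetricSpace K] [CompactSpace K] [Nonempty K]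
    [MeasurableSpace Ω₀] [MeasurableSpace Ω] [MeasurableSpace Ω']
    (P₀ : Measure Ω₀) [IsProbabilityMeasure P₀]
    (P : Measure Ω) [IsProbabilityMeasure P]
    (P' : Measure Ω') [IsProbabilityMeasure P']
    (V : Ω₀ → K → ℝ≥0) (hV : MaxStable.IsSpectralProcess V P₀)
    (Γ : ℕ → Ω → ℝ) (W : ℕ → Ω → K → ℝ≥0) (hΓW : MaxStable.IsMarkedPoisson Γ W P V P₀)
    (Z : Ω' → K → ℝ≥0) (hZ : MaxStable.HasSpectralRepresentation Z P' Γ W P)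
    (τ : ℝ≥0) (hτ : 0 < τ) :
    -- (a)
    (τ : ℝ≥0∞) * ∫⁻ ω', (⨅ x, (Z ω' x : ℝ≥0∞))⁻¹ ∂P' ≤
        ∫⁻ ω, (MaxStable.stoppingTime Γ W τ ω : ℝ≥0∞) ∂P ∧
    -- (b)
    (∫⁻ ω, (MaxStable.stoppingTime Γ W τ ω : ℝ≥0∞) ∂P =
          (τ : ℝ≥0∞) * ∫⁻ ω', (⨅ x, (Z ω' x : ℝ≥0∞))⁻¹ ∂P' ↔
        ∀ᵐ ω ∂P₀, ⨆ x, (V ω x : ℝ≥0∞) ≤ τ) ∧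
    -- in this case threshold stopping is exact: the output is almost surely the full maximum, and
    -- it has the distribution of `Z`
    ((∀ᵐ ω ∂P₀, ⨆ x, (V ω x : ℝ≥0∞) ≤ τ) →
        (∀ᵐ ω ∂P, ∀ x, MaxStable.stoppedMax Γ W τ ω x = MaxStable.partialMax Γ W ⊤ ω x) ∧
        IdentDistrib (MaxStable.stoppedMax Γ W τ) (fun ω' x => (Z ω' x : ℝ≥0∞)) P P') := by
  obtain ⟨d, hd⟩ := TopologicalSpace.exists_dense_seq K
  have hA := hΓW.arrivals
  have hG := fun n => MaxStable.measurable_arrivalTime hA.measurable_waiting n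
  have hH := fun n => MaxStable.measurable_horizon d τ hA.measurable_waiting
    hΓW.measurable_marks n
  have hge : ∀ᵐ ω ∂P, MaxStable.horizon d τ (MaxStable.waiting Γ ω) (fun j => W j ω) ⊤ ≤
      ∑' n : ℕ, (min (MaxStable.arrivalTime (MaxStable.waiting Γ ω) (n + 1))
        (MaxStable.horizon d τ (MaxStable.waiting Γ ω) (fun j => W j ω) n) -
        MaxStable.arrivalTime (MaxStable.waiting Γ ω) n) := by
    filter_upwards [hA.ae_tsum_waiting] with ω hω
    exact MaxStable.horizon_top_le_tsum d τ hω _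
  rw [hZ.mul_lintegral_inv_iInf hA hd, hΓW.lintegral_stoppingTime hd hτ]
  refine ⟨lintegral_mono_ae hge, ⟨fun heq => ?_, fun hle => ?_⟩, fun hle => ?_⟩
  · by_contra hnot
    -- By path continuity an excess over `τ` is already seen at a single point of the dense
    -- sequence.
    have hk : ∃ k, P₀ {ω | τ < V ω (d k)} ≠ 0 := by
      by_contra! hall
      refine hnot ?_
      have h1 : ∀ᵐ ω ∂P₀, ∀ k, V ω (d k) ≤ τ := by
        rw [ae_all_iff]
        intro k
        simpa only [ae_iff, not_le] using hall k
      filter_upwards [h1] with ω hω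
      refine iSup_le fun x => ?_
      exact_mod_cast MaxStable.forall_le_of_denseRange hd
        (hV.sampleContinuous.continuous ω) hω x
    obtain ⟨k, hk⟩ := hk
    refine hΓW.not_ae_tsum_eq_horizon hV d hτ hk ?_
    -- Ordered functions with equal finite integrals agree almost everywhere; this is where the
    -- finite mean horizon enters.
    have hae := ae_eq_of_ae_le_of_lintegral_le hge (hΓW.lintegral_horizon_ne_top hV d τ)
      (Measurable.aemeasurable
        (Measurable.tsum fun n : ℕ => ((hG (n + 1)).min (hH n)).sub (hG n))) heq.le
    filter_upwards [hae] with ω hω using hω.symm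
  · refine lintegral_congr_ae ?_
    filter_upwards [hΓW.ae_marks_le hd hle, hA.ae_tsum_waiting] with ω h1 h2
    exact MaxStable.tsum_eq_horizon_top d hτ h2 fun j k => h1 j (d k)
  · have hae := hΓW.ae_stoppedMax_eq hd hle
    refine ⟨hae, ?_⟩
    have hae' : MaxStable.partialMax Γ W ⊤ =ᵐ[P] MaxStable.stoppedMax Γ W τ := by
      filter_upwards [hae] with ω hω
      exact funext fun x => (hω x).symm
    exact (IdentDistrib.of_ae_eq hZ.identDistrib.aemeasurable_snd hae').symm.trans
      hZ.identDistrib.symm
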